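/- Let $H,U$ be complex Hilbert spaces, let $A$ generate a $C_0$-semigroup $(e^{At})_{t\ge 0}$ on $H$, let $(\mathrm{dom}\,A^*)'\supset H$ be the dual of $\mathrm{dom}\,A^*$ (with the graph norm) with respect to the pivot space $H$, and let $e^{\mathcal A t}$ be the $C_0$-semigroup on $(\mathrm{dom}\,A^*)'$ which extends $e^{At}$. Let $B\in\mathcal L(U,(\mathrm{dom}\,A^*)')$ and, for $y_0\in H$ and $u\in L^2_{\rm loc}(0,+\infty;U)$, put $$y^{y_0,u}(t)=e^{At}y_0+\int_0^t e^{\mathcal A(t-s)}Bu(s)\,ds ,\qquad t\ge 0,$$ with the integral taken in $(\mathrm{dom}\,A^*)'$. A control $u\in L^2_{\rm loc}(0,+\infty;U)$ steers $y_0$ to the rest in time at most $T$ if $u$ and $y^{y_0,u}$ both have support in $[0,T]$. The system is null controllable in time $T$ if every $y_0\in H$ can be steered to the rest in time at most $T$. It is NCVE (null controllable with vanishing energy) if for every $y_0\in H$ and every $\epsilon>0$ there are $T_\epsilon>0$ and a control $u_\epsilon$ which steers $y_0$ to the rest in time at most $T_\epsilon$ and satisfies $\int_0^{+\infty}|u_\epsilon(s)|^2ds\le\epsilon^2$.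 Assume: (1) for every $T>0$ the map $u\mapsto \int_0^{\cdot} e^{\mathcal A(\cdot-s)}Bu(s)\,ds$ is linear and continuous from $L^2(0,T;U)$ into $L^2(0,T;H)$; (2) there are closed linear subspaces $H_s,H_1$ of $H$ with $H=H_s\oplus H_1$, such that $\lim_{t\to+\infty}e^{At}x=0$ for every $x\in H_s$, the subspace $H_1$ is invariant for the semigroup, and the set of the generalized eigenvectors of $A$ (the elements of $\bigcup_{k\ge1}\mathrm{Ker}\,(\lambda I-A)^k$, $\lambda\in\mathbb C$) contained in $H_1$ is linearly dense in $H_1$ (possibly $H_1=\{0\}$); (3) $s(A)=\sup\{\mathrm{Re}\,\lambda:\lambda\in\sigma(A)\}\le 0$ (with $s(A)=-\infty$ if $\sigma(A)=\emptyset$); (4) the system is null controllable in some time $T>0$. Then the system is NCVE. Moreover, the minimal-energy operator exists, is unique and vanishes: the only $P=P^*\in\mathcal L(H)$ such that, for all $y_0\in H$, $$\langle y_0,Py_0\rangle=\inf\Big\{\int_0^{+\infty}|u(s)|^2ds\ :\ u\in L^2(0,+\infty;U),\ y^{y_0,u}\in L^2(0,+\infty;H)\Big\}$$ is $P=0$.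 -/

import Mathlib

open MeasureTheory Filter Topology Set
open scoped NNReal ComplexConjugate

noncomputable section

/-! ## Unbounded operators: resolvent set, spectrum, spectral bound, generalized eigenvectors -/

namespace LinearPMap

variable {H : Type*} [NormedAddCommGroup H] [InnerProductSpace ℂ H]

/-- `l` belongs to the resolvent set of the (unbounded) operator `A` if
`l I - A : dom A → H` is a bijection with bounded inverse `R`. -/
def InResolventSet (A : H →ₗ.[ℂ] H) (l : ℂ) : Prop :=
  ∃ R : H →L[ℂ] H,
    (∀ y : H, ∃ h : R y ∈ A.domain, l • R y - A ⟨R y, h⟩ = y) ∧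
    (∀ x : A.domain, R (l • (x : H) - A x) = x)

/-- The spectrum `σ(A)` of an unbounded operator. -/
def unboundedSpectrum (A : H →ₗ.[ℂ] H) : Set ℂ :=
  {l | ¬ A.InResolventSet l}

/-- The spectral bound `s(A) = sup {Re l : l ∈ σ(A)}`, equal to `-∞` if `σ(A)` is empty. -/
def spectralBound (A : H →ₗ.[ℂ] H) : EReal :=
  ⨆ l ∈ A.unboundedSpectrum, (l.re : EReal)

/-- `x ∈ Ker ((l I - A) ^ k)`, where the domain of a power is the natural one. -/
def InKerPow (A : H →ₗ.[ℂ] H) (l : ℂ) : ℕ → H → Prop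
  | 0, x => x = 0
  | k + 1, x => ∃ h : x ∈ A.domain, InKerPow A l k (l • x - A ⟨x, h⟩)

/-- `x` is a generalized eigenvector of `A`: `x ∈ ⋃_{k ≥ 1} Ker ((l I - A) ^ k)` for some `l`.
(The zero vector is allowed; if `x ≠ 0` then `l` is automatically an eigenvalue.) -/
def IsGeneralizedEigenvector (A : H →ₗ.[ℂ] H) (x : H) : Prop :=
  ∃ l : ℂ, ∃ k : ℕ, 1 ≤ k ∧ A.InKerPow l k x

end LinearPMap

/-! ## Strongly continuous semigroups and their generators -/

/-- A strongly continuous semigroup `(e^{At})_{t ≥ 0}` of bounded operators on `H`. -/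
structure C0Semigroup (H : Type*) [NormedAddCommGroup H] [InnerProductSpace ℂ H] where
  /-- The operator `e^{At}`. -/
  op : ℝ≥0 → H →L[ℂ] H
  op_zero : op 0 = ContinuousLinearMap.id ℂ H
  op_add : ∀ s t : ℝ≥0, op (s + t) = (op s).comp (op t)
  continuous_op : ∀ x : H, Continuous fun t => op t x

namespace C0Semigroup

variable {H : Type*} [NormedAddCommGroup H] [InnerProductSpace ℂ H]

/-- The graph of the generator: all pairs `(x, y)` with `(e^{At} x - x) / t → y` as `t → 0+`. -/
def generatorGraph (S : C0Semigroup H) : Submodule ℂ (H × H) where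
  carrier := {p | Tendsto (fun t : ℝ≥0 => (t : ℝ)⁻¹ • (S.op t p.1 - p.1)) (𝓝[>] 0) (𝓝 p.2)}
  zero_mem' := by simp
  add_mem' := by
    intro p q hp hq
    simp only [Set.mem_ofPred_eq] at hp hq ⊢
    refine (hp.add hq).congr fun t => ?_
    rw [← smul_add, Prod.fst_add, map_add]
    congr 1
    abel
  smul_mem' := by
    intro c p hp
    simp only [Set.mem_ofPred_eq] at hp ⊢
    refine (hp.const_smul c).congr fun t => ?_
    rw [smul_comm, Prod.smul_fst, map_smul, smul_sub]

/-- The infinitesimal generator `A` of the semigroup, as an unbounded operator. -/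
def generator (S : C0Semigroup H) : H →ₗ.[ℂ] H := S.generatorGraph.toLinearPMap

lemma mem_graph_generator_iff (S : C0Semigroup H) (p : H × H) :
    p ∈ S.generator.graph ↔
      Tendsto (fun t : ℝ≥0 => (t : ℝ)⁻¹ • (S.op t p.1 - p.1)) (𝓝[>] 0) (𝓝 p.2) := by
  have h : S.generatorGraph.toLinearPMap.graph = S.generatorGraph := by
    refine Submodule.toLinearPMap_graph_eq _ ?_
    intro x hx hx'
    have hx2 : Tendsto (fun t : ℝ≥0 => (t : ℝ)⁻¹ • (S.op t x.1 - x.1)) (𝓝[>] 0) (𝓝 x.2) := hx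
    rw [hx'] at hx2
    simp only [map_zero, sub_zero, smul_zero] at hx2
    exact (tendsto_nhds_unique hx2 tendsto_const_nhds)
  rw [generator, h]
  rfl

/-- The semigroup maps `dom A` into itself and commutes with `A` there. -/
lemma generator_op (S : C0Semigroup H) (t : ℝ≥0) (x : S.generator.domain) :
    ∃ h : S.op t x ∈ S.generator.domain, S.generator ⟨S.op t x, h⟩ = S.op t (S.generator x) := by
  have hx : ((x : H), S.generator x) ∈ S.generator.graph := S.generator.mem_graph x
  rw [mem_graph_generator_iff] at hx
  have h2 : (S.op t x, S.op t (S.generator x)) ∈ S.generator.graph := by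
    rw [mem_graph_generator_iff]
    refine (((S.op t).continuous.tendsto _).comp hx).congr fun s => ?_
    have hc : S.op t (S.op s x) = S.op s (S.op t x) := by
      have h1 := congrArg (fun f => f (x : H)) (S.op_add t s)
      have h2 := congrArg (fun f => f (x : H)) (S.op_add s t)
      simp only [ContinuousLinearMap.comp_apply] at h1 h2
      rw [← h1, ← h2, add_comm]
    simp only [Function.comp_apply]
    rw [← hc, ← map_sub, ← ContinuousLinearMap.map_smul_of_tower]
  obtain ⟨y, hy1, hy2⟩ := (LinearPMap.mem_graph_iff _).1 h2
  simp only at hy1 hy2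
  refine ⟨hy1 ▸ y.2, ?_⟩
  rw [← hy2]
  congr 1
  exact Subtype.ext hy1.symm

variable [CompleteSpace H]

/-! ## The Hilbert space `dom A*` with the graph inner product -/

/-- The domain of the Hilbert space adjoint `A*`, to be equipped with the graph norm. -/
def DomAdj (S : C0Semigroup H) : Type _ := S.generator.adjoint.domain

instance (S : C0Semigroup H) : AddCommGroup S.DomAdj :=
  inferInstanceAs (AddCommGroup S.generator.adjoint.domain)

instance (S : C0Semigroup H) : Module ℂ S.DomAdj :=
  inferInstanceAs (Module ℂ S.generator.adjoint.domain)

/-- The inclusion of `dom A*` into `H`, as a linear map. -/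
def domAdjIncl (S : C0Semigroup H) : S.DomAdj →ₗ[ℂ] H := S.generator.adjoint.domain.subtype

/-- The operator `A* : dom A* → H`, as a linear map. -/
def adjOp (S : C0Semigroup H) : S.DomAdj →ₗ[ℂ] H := S.generator.adjoint.toFun

/-- The graph inner product `⟨v, w⟩ + ⟨A* v, A* w⟩` on `dom A*`. -/
@[reducible] def domAdjCore (S : C0Semigroup H) : InnerProductSpace.Core ℂ S.DomAdj where
  inner v w := inner ℂ (S.domAdjIncl v) (S.domAdjIncl w) + inner ℂ (S.adjOp v) (S.adjOp w)
  conj_inner_symm v w := by simp only [map_add, inner_conj_symm]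
  re_inner_nonneg v := by
    rw [map_add]
    exact add_nonneg inner_self_nonneg inner_self_nonneg
  add_left u v w := by simp only [map_add, inner_add_left]; ring
  smul_left v w r := by simp only [map_smul, inner_smul_left]; ring
  definite v hv := by
    have h1 : 0 ≤ RCLike.re (inner ℂ (S.domAdjIncl v) (S.domAdjIncl v)) := inner_self_nonneg
    have h2 : 0 ≤ RCLike.re (inner ℂ (S.adjOp v) (S.adjOp v)) := inner_self_nonneg
    have h3 := congrArg RCLike.re hv
    rw [map_add, map_zero] at h3
    have h4 : RCLike.re (inner ℂ (S.domAdjIncl v) (S.domAdjIncl v)) = 0 := by linarith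
    have h5 : S.domAdjIncl v = 0 := by
      rw [inner_self_eq_norm_sq] at h4
      exact norm_eq_zero.1 (pow_eq_zero_iff two_ne_zero |>.1 h4)
    exact Subtype.ext h5

instance (S : C0Semigroup H) : NormedAddCommGroup S.DomAdj :=
  (S.domAdjCore).toNormedAddCommGroup

instance (S : C0Semigroup H) : InnerProductSpace ℂ S.DomAdj :=
  InnerProductSpace.ofCore (S.domAdjCore).toCore

lemma domAdj_norm_sq (S : C0Semigroup H) (v : S.DomAdj) :
    ‖v‖ ^ 2 = ‖S.domAdjIncl v‖ ^ 2 + ‖S.adjOp v‖ ^ 2 := by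
  rw [← inner_self_eq_norm_sq (𝕜 := ℂ) v, ← inner_self_eq_norm_sq (𝕜 := ℂ) (S.domAdjIncl v),
    ← inner_self_eq_norm_sq (𝕜 := ℂ) (S.adjOp v), ← map_add]
  rfl

/-- The continuous inclusion of `dom A*` (with the graph norm) into `H`. -/
def domAdjInclL (S : C0Semigroup H) : S.DomAdj →L[ℂ] H :=
  S.domAdjIncl.mkContinuous 1 fun v => by
    rw [one_mul]
    refine le_of_sq_le_sq ?_ (norm_nonneg _)
    rw [domAdj_norm_sq]
    exact le_add_of_nonneg_right (sq_nonneg _)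

/-- `e^{A* t} = (e^{At})*` maps `dom A*` into itself and commutes with `A*` there. -/
lemma adjoint_op (S : C0Semigroup H) (t : ℝ≥0) (v : S.generator.adjoint.domain) :
    ∃ h : (S.op t).adjoint v ∈ S.generator.adjoint.domain,
      S.generator.adjoint ⟨(S.op t).adjoint v, h⟩
        = (S.op t).adjoint (S.generator.adjoint v) := by
  have hmem : (S.op t).adjoint v ∈ S.generator.adjoint.domain := by
    have hv := (LinearPMap.mem_adjoint_domain_iff _ _).1 v.2
    rw [LinearPMap.mem_adjoint_domain_iff]
    let r : S.generator.domain → S.generator.domain :=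
      fun x => ⟨S.op t x, (S.generator_op t x).1⟩
    have hr : Continuous r :=
      Continuous.subtype_mk ((S.op t).continuous.comp continuous_subtype_val) _
    convert hv.comp hr using 1
    funext x
    obtain ⟨h, hx⟩ := S.generator_op t x
    change inner ℂ ((S.op t).adjoint v) (S.generator x)
      = inner ℂ (v : H) (S.generator ⟨S.op t x, h⟩)
    rw [hx, ContinuousLinearMap.adjoint_inner_left]
  refine ⟨hmem, ?_⟩
  by_cases hd : Dense (S.generator.domain : Set H)
  · refine LinearPMap.adjoint_apply_eq hd _ fun x => ?_
    obtain ⟨h, hx⟩ := S.generator_op t x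
    rw [ContinuousLinearMap.adjoint_inner_left, ContinuousLinearMap.adjoint_inner_left, ← hx]
    exact LinearPMap.adjoint_isFormalAdjoint hd v ⟨S.op t x, h⟩
  · rw [LinearPMap.adjoint_apply_of_not_dense hd, LinearPMap.adjoint_apply_of_not_dense hd,
      map_zero]

/-- The restriction of `e^{A* t} = (e^{At})*` to `dom A*`, bounded for the graph norm. -/
def adjSemigroup (S : C0Semigroup H) (t : ℝ≥0) : S.DomAdj →L[ℂ] S.DomAdj :=
  LinearMap.mkContinuous
    (((S.op t).adjoint.toLinearMap.restrict fun v hv => (S.adjoint_op t ⟨v, hv⟩).1 :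
      S.generator.adjoint.domain →ₗ[ℂ] S.generator.adjoint.domain) : S.DomAdj →ₗ[ℂ] S.DomAdj)
    ‖(S.op t).adjoint‖ fun v => by
      refine le_of_sq_le_sq ?_ (by positivity)
      rw [mul_pow, domAdj_norm_sq, domAdj_norm_sq, mul_add, ← mul_pow, ← mul_pow]
      refine add_le_add ?_ ?_
      · gcongr
        exact (S.op t).adjoint.le_opNorm _
      · gcongr
        refine le_trans (le_of_eq ?_) ((S.op t).adjoint.le_opNorm _)
        exact congrArg norm (S.adjoint_op t v).2

/-! ## The extrapolation space `(dom A*)'` and the extended semigroup -/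

/-- The space `(dom A*)'`. It is realised as the Banach space of continuous conjugate-linear
functionals on `dom A*`, so that `H ⊆ (dom A*)'` is a complex linear inclusion. -/
abbrev Extrap (S : C0Semigroup H) : Type _ := S.DomAdj →L⋆[ℂ] ℂ

/-- The embedding of `H` into `(dom A*)'`: the vector `h` is identified with the functional
`v ↦ ⟨v, h⟩` (Mathlib's inner product is conjugate-linear in the first variable). -/
def embed (S : C0Semigroup H) (h : H) : S.Extrap :=
  (innerSLFlip ℂ h).comp S.domAdjInclL

/-- The extended semigroup `e^{𝒜t}` on `(dom A*)'`: the dual of the semigroup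
`e^{A* t}` on `dom A*`, that is `(e^{𝒜t} φ)(v) = φ (e^{A* t} v)`. -/
def extOp (S : C0Semigroup H) (t : ℝ≥0) (φ : S.Extrap) : S.Extrap :=
  φ.comp (S.adjSemigroup t)

lemma embed_apply (S : C0Semigroup H) (h : H) (v : S.DomAdj) :
    S.embed h v = inner ℂ (S.domAdjIncl v) h := rfl

/-- `e^{𝒜t}` extends `e^{At}`. -/
lemma extOp_embed (S : C0Semigroup H) (t : ℝ≥0) (h : H) :
    S.extOp t (S.embed h) = S.embed (S.op t h) := by
  ext v
  change inner ℂ ((S.op t).adjoint (S.domAdjIncl v)) h = inner ℂ (S.domAdjIncl v) (S.op t h)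
  rw [ContinuousLinearMap.adjoint_inner_left]

/-! ## The control system `y' = 𝒜 y + B u`, `y(0) = y₀` -/

variable {U : Type*} [NormedAddCommGroup U] [InnerProductSpace ℂ U]

/-- The input-to-state map `(L u)(t) = ∫₀ᵗ e^{𝒜(t-s)} B u(s) ds`, a Bochner integral
in `(dom A*)'`. -/
def inputMap (S : C0Semigroup H) (B : U →L[ℂ] S.Extrap) (u : ℝ → U) (t : ℝ) : S.Extrap :=
  ∫ s in (0 : ℝ)..t, S.extOp (t - s).toNNReal (B (u s))

/-- For every `T > 0`, `u ↦ L u` is a continuous linear map from `L²(0,T;U)` to `L²(0,T;H)`. -/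
def InputRegular (S : C0Semigroup H) (B : U →L[ℂ] S.Extrap) : Prop :=
  ∀ T : ℝ, 0 < T →
    ∃ Λ : Lp U 2 (volume.restrict (Ioo 0 T)) →L[ℂ] Lp H 2 (volume.restrict (Ioo 0 T)),
      ∀ u : Lp U 2 (volume.restrict (Ioo 0 T)),
        ∀ᵐ t ∂(volume.restrict (Ioo 0 T)), S.embed (Λ u t) = S.inputMap B u t

/-- The solution `y(t; y₀, u) = e^{At} y₀ + ∫₀ᵗ e^{𝒜(t-s)} B u(s) ds` for `t ≥ 0`, with values in
`(dom A*)'`. -/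
def trajectory (S : C0Semigroup H) (B : U →L[ℂ] S.Extrap) (y₀ : H) (u : ℝ → U) (t : ℝ) :
    S.Extrap :=
  S.embed (S.op t.toNNReal y₀) + S.inputMap B u t

/-- Controls: the elements of `L²_loc(0,+∞;U)`, i.e. square integrable on `(0,T)` for all `T`. -/
def IsControl (u : ℝ → U) : Prop :=
  ∀ T : ℝ, MemLp u 2 (volume.restrict (Ioo 0 T))

/-- The control `u` steers `y₀` to the rest in time at most `T`: both `u` and the corresponding
solution have support in `[0,T]`. -/
def Steers (S : C0Semigroup H) (B : U →L[ℂ] S.Extrap) (y₀ : H) (T : ℝ) (u : ℝ → U) : Prop :=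
  IsControl u ∧ (∀ᵐ t ∂(volume.restrict (Ioi T)), u t = 0) ∧
    ∀ᵐ t ∂(volume.restrict (Ioi T)), S.trajectory B y₀ u t = 0

/-- Every initial state in `H` can be steered to the rest in time at most `T`. -/
def NullControllableInTime (S : C0Semigroup H) (B : U →L[ℂ] S.Extrap) (T : ℝ) : Prop :=
  ∀ y₀ : H, ∃ u : ℝ → U, S.Steers B y₀ T u

/-- The energy `∫₀^∞ |u(s)|² ds` of a control. -/
def energy (u : ℝ → U) : ℝ := ∫ s in Ioi (0 : ℝ), ‖u s‖ ^ 2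

/-- Null controllability with vanishing energy (NCVE). -/
def IsNCVE (S : C0Semigroup H) (B : U →L[ℂ] S.Extrap) : Prop :=
  ∀ y₀ : H, ∀ ε : ℝ, 0 < ε → ∃ T : ℝ, 0 < T ∧ ∃ u : ℝ → U, S.Steers B y₀ T u ∧ energy u ≤ ε ^ 2

/-- There is a decomposition `H = H_s ⊕ H_1` into closed subspaces such that `e^{At} x → 0` for
all `x ∈ H_s`, the subspace `H_1` is invariant for the semigroup, and the generalized eigenvectors
of `A` contained in `H_1` are linearly dense in `H_1`. -/
def HasSpectralDecomposition (S : C0Semigroup H) : Prop :=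
  ∃ Hs H1 : Submodule ℂ H,
    IsClosed (Hs : Set H) ∧ IsClosed (H1 : Set H) ∧ IsCompl Hs H1 ∧
    (∀ x ∈ Hs, Tendsto (fun t : ℝ≥0 => S.op t x) atTop (𝓝 0)) ∧
    (∀ t : ℝ≥0, ∀ x ∈ H1, S.op t x ∈ H1) ∧
    (Submodule.span ℂ
      {x | x ∈ H1 ∧ S.generator.IsGeneralizedEigenvector x}).topologicalClosure = H1

/-- The class `𝒰(y₀)` of the controls `u ∈ L²(0,+∞;U)` whose solution is in `L²(0,+∞;H)`. -/
def admissibleControls (S : C0Semigroup H) (B : U →L[ℂ] S.Extrap) (y₀ : H) : Set (ℝ → U) :=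
  {u | MemLp u 2 (volume.restrict (Ioi 0)) ∧
    ∃ y : ℝ → H, MemLp y 2 (volume.restrict (Ioi 0)) ∧
      ∀ᵐ t ∂(volume.restrict (Ioi 0)), S.embed (y t) = S.trajectory B y₀ u t}

/-- `P` is the minimal-energy operator: `P = P* ∈ ℒ(H)` and `⟨y₀, P y₀⟩` is, for all `y₀ ∈ H`, the
infimum `I(y₀)` of the energy over `𝒰(y₀)`. (In particular `𝒰(y₀)` is non-empty, since the empty
subset of `ℝ` has no greatest lower bound; `⟨y₀, P y₀⟩` is real since `P = P*`.) -/
def IsMinimalEnergyOperator (S : C0Semigroup H) (B : U →L[ℂ] S.Extrap) (P : H →L[ℂ] H) : Prop :=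
  IsSelfAdjoint P ∧
    ∀ y₀ : H, IsGLB (energy '' S.admissibleControls B y₀) (inner ℂ y₀ (P y₀)).re

end C0Semigroup

end

/-! Let V(y) be the infimum of the energies of the controls that bring y to rest in some finite time
(`ControlSystem.cost`). Everything follows from V = 0.

By superposition V(cy) ≤ |c|²V(y) and V(y+z) ≤ 2V(y) + 2V(z), and by the open mapping theorem V(y) ≤
C‖y‖² (`exists_cost_le`). Hence N = {V = 0} is a closed subspace, and it is enough to place H_s and
the generalized eigenvectors of H_1 inside it. Waiting costs nothing, so V(x) ≤ V(e^{At}x) ≤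
C‖e^{At}x‖², which tends to 0 for x in H_s.

The main device is `SteersWithin.cost_le_quarter`. If u brings z to rest at time τ, then u/2 brings
z to e^{Aτ}z/2, whence V(z) ≤ |u|²/4 + V(e^{Aτ}z)/4. If V is bounded on the orbit of z, with
supremum Q, this gives Q ≤ Q/4 + Q/4, so Q = 0 (`cost_eq_zero_of_bounded`).

For x in Ker (λI - A)^k one argues by induction on k. The orbit of (λI - A)x lies in N, so e^{At}x
equals e^{λt}x modulo N (`op_sub_exp_smul_mem`). Since Re λ ≤ 0, V is at most 2V(x) on the orbit of
x, and hence V(x) = 0.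

Finally, by input regularity, the steering controls of small energy are admissible on the half-line,
so the quadratic form of a minimal-energy operator vanishes, and a symmetric operator with zero form
is zero. -/

namespace C0Semigroup

/-! ### Orbits of a strongly continuous semigroup and density of the domain of its generator -/

section Semigroup

variable {H : Type*} [NormedAddCommGroup H] [InnerProductSpace ℂ H]

lemma op_add_apply (S : C0Semigroup H) (s t : ℝ≥0) (x : H) :
    S.op (s + t) x = S.op s (S.op t x) := by
  rw [S.op_add]; rfl

lemma op_zero_apply (S : C0Semigroup H) (x : H) : S.op 0 x = x := by
  rw [S.op_zero]; rfl

lemma continuous_op_toNNReal (S : C0Semigroup H) (x : H) :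
    Continuous fun t : ℝ => S.op t.toNNReal x :=
  (S.continuous_op x).comp continuous_real_toNNReal

lemma tendsto_coe_nhdsGT_zero :
    Tendsto (fun t : ℝ≥0 => (t : ℝ)) (𝓝[>] 0) (𝓝[>] 0) := by
  refine tendsto_nhdsWithin_of_tendsto_nhds_of_eventually_within _ ?_ ?_
  · exact (NNReal.continuous_coe.tendsto' 0 0 (by simp)).mono_left nhdsWithin_le_nhds
  · filter_upwards [self_mem_nhdsWithin] with t ht
    exact NNReal.coe_pos.2 ht

lemma tendsto_toNNReal_nhdsGT_zero :
    Tendsto Real.toNNReal (𝓝[>] 0) (𝓝[>] 0) := by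
  refine tendsto_nhdsWithin_of_tendsto_nhds_of_eventually_within _ ?_ ?_
  · exact (continuous_real_toNNReal.tendsto' 0 0 (by simp)).mono_left nhdsWithin_le_nhds
  · filter_upwards [self_mem_nhdsWithin] with t ht
    exact Real.toNNReal_pos.2 ht

/-- Right derivative of an orbit starting in the domain of the generator. -/
lemma hasDerivWithinAt_op (S : C0Semigroup H) (x : S.generator.domain) {t : ℝ} (ht : 0 ≤ t) :
    HasDerivWithinAt (fun s : ℝ => S.op s.toNNReal x)
      (S.op t.toNNReal (S.generator x)) (Ici t) t := by
  rw [← hasDerivWithinAt_Ioi_iff_Ici, hasDerivWithinAt_iff_tendsto_slope' (by simp)]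
  have h0 : Tendsto (fun s : ℝ => s - t) (𝓝[>] t) (𝓝[>] 0) := by
    refine tendsto_nhdsWithin_of_tendsto_nhds_of_eventually_within _ ?_ ?_
    · exact ((continuous_sub_right t).tendsto' t 0 (by simp)).mono_left nhdsWithin_le_nhds
    · filter_upwards [self_mem_nhdsWithin] with s hs
      exact mem_Ioi.2 (sub_pos.2 (mem_Ioi.1 hs))
  obtain ⟨h, hx⟩ := S.generator_op t.toNNReal x
  have h1 := (S.mem_graph_generator_iff _).1 (S.generator.mem_graph ⟨_, h⟩)
  rw [hx] at h1
  refine (h1.comp (tendsto_toNNReal_nhdsGT_zero.comp h0)).congr' ?_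
  filter_upwards [self_mem_nhdsWithin] with s hs
  have hs' : 0 ≤ s - t := (sub_pos.2 (mem_Ioi.1 hs)).le
  simp only [Function.comp_apply, slope_def_module]
  rw [Real.coe_toNNReal _ hs', ← S.op_add_apply, ← Real.toNNReal_add hs' ht, sub_add_cancel]

variable [CompleteSpace H]

lemma exists_norm_op_le (S : C0Semigroup H) (T : ℝ≥0) :
    ∃ M : ℝ, 0 < M ∧ ∀ t ≤ T, ‖S.op t‖ ≤ M := by
  obtain ⟨C, hC⟩ := banach_steinhaus (g := fun t : Set.Iic T => S.op t) (fun x => by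
    obtain ⟨C, hC⟩ := (isCompact_Icc (a := (0 : ℝ≥0)) (b := T)).exists_bound_of_continuousOn
      (S.continuous_op x).continuousOn
    exact ⟨C, fun t => hC t ⟨zero_le, t.2⟩⟩)
  exact ⟨max C 1, by positivity, fun t ht => (hC ⟨t, ht⟩).trans (le_max_left _ _)⟩

/-- The integral mean of an orbit lies in the domain of the generator. -/
lemma integral_op_mem_domain (S : C0Semigroup H) (x : H) (t : ℝ≥0) :
    (∫ s in (0 : ℝ)..t, S.op s.toNNReal x) ∈ S.generator.domain := by
  have hc := S.continuous_op_toNNReal x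
  have hi : ∀ a b : ℝ, IntervalIntegrable (fun s : ℝ => S.op s.toNNReal x) volume a b :=
    fun a b => hc.intervalIntegrable a b
  -- Applying the semigroup at time h shifts the interval of integration, so only pieces of length h
  -- at the two ends survive. Their quotients converge to the orbit at t and at 0, and the generator
  -- takes the value e^{At}x - x.
  have hd : ∀ a : ℝ, Tendsto (fun h : ℝ≥0 => (h : ℝ)⁻¹ •
      ((∫ s in (0 : ℝ)..(a + h), S.op s.toNNReal x) - ∫ s in (0 : ℝ)..a, S.op s.toNNReal x))
      (𝓝[>] 0) (𝓝 (S.op a.toNNReal x)) := fun a =>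
    ((hc.integral_hasStrictDerivAt 0 a).hasDerivAt.tendsto_slope_zero_right).comp
      tendsto_coe_nhdsGT_zero
  refine LinearPMap.mem_domain_of_mem_graph (y := S.op (t : ℝ).toNNReal x - S.op (0 : ℝ).toNNReal x)
    ((S.mem_graph_generator_iff _).2 ?_)
  refine ((hd t).sub (hd 0)).congr fun h => ?_
  rw [← smul_sub]
  congr 1
  have h1 : S.op h (∫ s in (0 : ℝ)..t, S.op s.toNNReal x)
      = ∫ s in (0 : ℝ)..t, S.op (s + h).toNNReal x := by
    rw [← ContinuousLinearMap.intervalIntegral_comp_comm _ (hi _ _)]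
    refine intervalIntegral.integral_congr fun s hs => ?_
    rw [uIcc_of_le (NNReal.coe_nonneg t)] at hs
    rw [Real.toNNReal_add hs.1 (NNReal.coe_nonneg h), Real.toNNReal_coe, add_comm, S.op_add_apply]
  rw [h1, intervalIntegral.integral_comp_add_right (fun s => S.op s.toNNReal x)]
  have h2 := intervalIntegral.integral_add_adjacent_intervals (hi 0 (0 + h)) (hi (0 + h) (t + h))
  rw [← h2]
  simp only [intervalIntegral.integral_same]
  abel

/-- The means of the orbit over [0,t] lie in the domain and converge to x as t → 0+. Density is what
makes the adjoint a closed operator. -/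
lemma dense_generator_domain (S : C0Semigroup H) : Dense (S.generator.domain : Set H) := by
  intro x
  have hc := S.continuous_op_toNNReal x
  have hd := ((hc.integral_hasStrictDerivAt 0 0).hasDerivAt.tendsto_slope_zero_right).comp
    tendsto_coe_nhdsGT_zero
  rw [Real.toNNReal_zero, S.op_zero_apply] at hd
  refine mem_closure_of_tendsto hd (Eventually.of_forall fun t => ?_)
  simp only [Function.comp_apply, intervalIntegral.integral_same, sub_zero, zero_add]
  exact Submodule.smul_of_tower_mem _ _ (S.integral_op_mem_domain x t)

end Semigroup

/-! ### Completeness of dom A* and joint continuity of the extended semigroup -/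

section Extrapolation

variable {H : Type*} [NormedAddCommGroup H] [InnerProductSpace ℂ H] [CompleteSpace H]

/-- The adjoint of a densely defined operator is closed, and closedness is completeness of the
domain in the graph norm. This opens the Riesz theorem on dom A*. -/
instance (S : C0Semigroup H) : CompleteSpace S.DomAdj := by
  have hcl : IsClosed (S.generator.adjoint.graph : Set (H × H)) :=
    LinearPMap.adjoint_isClosed S.dense_generator_domain
  have hb : ∀ v : S.DomAdj, ‖S.domAdjIncl v‖ ≤ ‖v‖ ∧ ‖S.adjOp v‖ ≤ ‖v‖ := fun v => by
    have h := S.domAdj_norm_sq v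
    constructor <;> refine le_of_sq_le_sq ?_ (norm_nonneg _) <;> rw [h]
    · exact le_add_of_nonneg_right (sq_nonneg _)
    · exact le_add_of_nonneg_left (sq_nonneg _)
  refine Metric.complete_of_cauchySeq_tendsto fun v hv => ?_
  have hc1 : CauchySeq fun n => S.domAdjIncl (v n) :=
    (S.domAdjIncl.mkContinuous 1 fun v => by simpa using (hb v).1).uniformContinuous.comp_cauchySeq hv
  have hc2 : CauchySeq fun n => S.adjOp (v n) :=
    (S.adjOp.mkContinuous 1 fun v => by simpa using (hb v).2).uniformContinuous.comp_cauchySeq hv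
  obtain ⟨a, ha⟩ := cauchySeq_tendsto_of_complete hc1
  obtain ⟨b, hb⟩ := cauchySeq_tendsto_of_complete hc2
  have hab : (a, b) ∈ S.generator.adjoint.graph :=
    hcl.mem_of_tendsto (ha.prodMk_nhds hb)
      (Eventually.of_forall fun n => S.generator.adjoint.mem_graph (v n))
  obtain ⟨w, hw1, hw2⟩ := (LinearPMap.mem_graph_iff _).1 hab
  let w' : S.DomAdj := w
  refine ⟨w', ?_⟩
  have hw1' : S.domAdjIncl w' = a := hw1
  have hw2' : S.adjOp w' = b := hw2
  rw [tendsto_iff_norm_sub_tendsto_zero] at ha hb ⊢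
  have hsq : Tendsto (fun n => Real.sqrt (‖S.domAdjIncl (v n) - a‖ ^ 2 + ‖S.adjOp (v n) - b‖ ^ 2))
      atTop (𝓝 0) := by
    have := ((ha.pow 2).add (hb.pow 2)).sqrt
    simpa using this
  refine hsq.congr fun n => ?_
  rw [← hw1', ← hw2', ← map_sub, ← map_sub, ← domAdj_norm_sq, Real.sqrt_sq (norm_nonneg _)]

lemma norm_embed_le (S : C0Semigroup H) (h : H) : ‖S.embed h‖ ≤ ‖h‖ := by
  refine ContinuousLinearMap.opNorm_le_bound _ (norm_nonneg _) fun v => ?_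
  rw [embed_apply, mul_comm]
  refine (norm_inner_le_norm _ _).trans ?_
  gcongr
  refine le_of_sq_le_sq ?_ (norm_nonneg _)
  rw [domAdj_norm_sq]
  exact le_add_of_nonneg_right (sq_nonneg _)

/-- The embedding of `H` into `(dom A*)'` as a continuous linear map. -/
noncomputable def embedL (S : C0Semigroup H) : H →L[ℂ] S.Extrap :=
  LinearMap.mkContinuous
    { toFun := S.embed
      map_add' := fun x y => by ext v; simp [embed_apply]
      map_smul' := fun c x => by ext v; simp [embed_apply] } 1
    fun h => by simpa using S.norm_embed_le h

lemma norm_adjSemigroup_le (S : C0Semigroup H) (t : ℝ≥0) : ‖S.adjSemigroup t‖ ≤ ‖S.op t‖ := by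
  refine (LinearMap.mkContinuous_norm_le _ (norm_nonneg _) _).trans ?_
  simp

lemma norm_extOp_le (S : C0Semigroup H) (t : ℝ≥0) (φ : S.Extrap) :
    ‖S.extOp t φ‖ ≤ ‖S.op t‖ * ‖φ‖ := by
  refine (ContinuousLinearMap.opNorm_comp_le _ _).trans ?_
  rw [mul_comm]
  gcongr
  exact S.norm_adjSemigroup_le t

/-- The extended semigroup as a family of continuous linear maps. -/
noncomputable def extOpL (S : C0Semigroup H) (t : ℝ≥0) : S.Extrap →L[ℂ] S.Extrap :=
  LinearMap.mkContinuous
    { toFun := S.extOp t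
      map_add' := fun x y => by ext v; simp [extOp]
      map_smul' := fun c x => by ext v; simp [extOp] } ‖S.op t‖
    fun φ => S.norm_extOp_le t φ

lemma extOp_add (S : C0Semigroup H) (s t : ℝ≥0) (φ : S.Extrap) :
    S.extOp (s + t) φ = S.extOp s (S.extOp t φ) := by
  ext v
  change φ _ = φ _
  congr 1
  refine Subtype.ext ?_
  change (S.op (s + t)).adjoint (S.domAdjIncl v)
    = (S.op t).adjoint ((S.op s).adjoint (S.domAdjIncl v))
  rw [S.op_add, ContinuousLinearMap.adjoint_comp]
  rfl

lemma extOp_zero (S : C0Semigroup H) (φ : S.Extrap) : S.extOp 0 φ = φ := by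
  ext v
  change φ _ = φ _
  congr 1
  refine Subtype.ext ?_
  change (S.op 0).adjoint (S.domAdjIncl v) = S.domAdjIncl v
  refine ext_inner_right ℂ fun w => ?_
  rw [ContinuousLinearMap.adjoint_inner_left, S.op_zero_apply]

/-- Up to the Riesz isomorphism the embedding is the adjoint of the inclusion of dom A* into H; that
inclusion is injective, so its adjoint has dense range. -/
lemma denseRange_embed (S : C0Semigroup H) : DenseRange S.embed := by
  have key : DenseRange (S.domAdjInclL.adjoint) := by
    have h : (S.domAdjInclL.adjoint.range).topologicalClosure = ⊤ := by
      rw [Submodule.topologicalClosure_eq_top_iff, ContinuousLinearMap.orthogonal_range,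
        ContinuousLinearMap.adjoint_adjoint, LinearMap.ker_eq_bot]
      intro v w hvw
      exact Subtype.ext hvw
    intro x
    have hx : x ∈ S.domAdjInclL.adjoint.range.topologicalClosure := h ▸ Submodule.mem_top
    exact hx
  have hsurj : Function.Surjective fun w : S.DomAdj => (innerSLFlip ℂ w : S.Extrap) := by
    intro φ
    let ψ : S.DomAdj →L[ℂ] ℂ :=
      { toFun := fun v => conj (φ v)
        map_add' := fun x y => by simp
        map_smul' := fun c x => by simp
        cont := Complex.continuous_conj.comp φ.continuous }
    refine ⟨(InnerProductSpace.toDual ℂ S.DomAdj).symm ψ, ?_⟩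
    ext v
    change inner ℂ v ((InnerProductSpace.toDual ℂ S.DomAdj).symm ψ) = φ v
    rw [← inner_conj_symm, InnerProductSpace.toDual_symm_apply]
    exact Complex.conj_conj _
  have := hsurj.denseRange.comp key (innerSLFlip ℂ).continuous
  convert this using 1
  funext h
  ext v
  change inner ℂ (S.domAdjInclL v) h = inner ℂ v (S.domAdjInclL.adjoint h)
  rw [ContinuousLinearMap.adjoint_inner_right]

lemma extOp_sub_right (S : C0Semigroup H) (t : ℝ≥0) (φ ψ : S.Extrap) :
    S.extOp t (φ - ψ) = S.extOp t φ - S.extOp t ψ := map_sub (S.extOpL t) φ ψ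

lemma embed_sub (S : C0Semigroup H) (x y : H) : S.embed (x - y) = S.embed x - S.embed y :=
  map_sub S.embedL x y

/-- Passing through a nearby vector h of H transfers strong continuity from H to the larger space.
-/
lemma norm_extOp_sub_extOp_le (S : C0Semigroup H) (s r : ℝ≥0) (φ ψ : S.Extrap) (h : H) :
    ‖S.extOp s ψ - S.extOp r φ‖ ≤ ‖S.op s‖ * ‖ψ - φ‖ + ‖S.op s‖ * ‖φ - S.embed h‖
      + ‖S.op s h - S.op r h‖ + ‖S.op r‖ * ‖φ - S.embed h‖ := by
  have e : S.extOp s ψ - S.extOp r φ = S.extOp s (ψ - φ) + S.extOp s (φ - S.embed h)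
      + (S.embed (S.op s h - S.op r h)) - S.extOp r (φ - S.embed h) := by
    rw [extOp_sub_right, extOp_sub_right, extOp_sub_right, embed_sub, extOp_embed, extOp_embed]
    abel
  rw [e]
  have h1 := norm_sub_le (S.extOp s (ψ - φ) + S.extOp s (φ - S.embed h)
      + (S.embed (S.op s h - S.op r h))) (S.extOp r (φ - S.embed h))
  have h2 := norm_add₃_le (a := S.extOp s (ψ - φ)) (b := S.extOp s (φ - S.embed h))
    (c := S.embed (S.op s h - S.op r h))
  have h3 := S.norm_extOp_le s (ψ - φ)
  have h4 := S.norm_extOp_le s (φ - S.embed h)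
  have h5 := S.norm_embed_le (S.op s h - S.op r h)
  have h6 := S.norm_extOp_le r (φ - S.embed h)
  linarith

/-- The extended semigroup is jointly continuous in time and state. -/
lemma continuous_extOp (S : C0Semigroup H) :
    Continuous fun p : ℝ≥0 × S.Extrap => S.extOp p.1 p.2 := by
  refine continuous_iff_continuousAt.2 fun ⟨r, φ⟩ => ?_
  obtain ⟨M, hM, hMb⟩ := S.exists_norm_op_le (r + 1)
  refine (Metric.tendsto_nhds (α := S.Extrap)).2 fun ε hε => ?_
  -- M bounds the semigroup on [0, r + 1], so each of the four terms of `norm_extOp_sub_extOp_le`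
  -- will be below ε/4.
  obtain ⟨h, hh⟩ := S.denseRange_embed.exists_dist_lt φ (ε := ε / (4 * M)) (by positivity)
  have h1 : ∀ᶠ p : ℝ≥0 × S.Extrap in 𝓝 (r, φ), p.1 ≤ r + 1 :=
    continuous_fst.continuousAt.eventually (Iic_mem_nhds (by simp))
  have h2 : ∀ᶠ p : ℝ≥0 × S.Extrap in 𝓝 (r, φ), dist (S.op p.1 h) (S.op r h) < ε / 4 :=
    (((S.continuous_op h).comp continuous_fst).tendsto (r, φ)).eventually
      (Metric.ball_mem_nhds _ (by positivity))
  have h3 : ∀ᶠ p : ℝ≥0 × S.Extrap in 𝓝 (r, φ), dist p.2 φ < ε / (4 * M) :=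
    (continuous_snd.tendsto (r, φ)).eventually (Metric.ball_mem_nhds φ (by positivity))
  filter_upwards [h1, h2, h3] with p h1 h2 h3
  replace h2 := (dist_eq_norm _ _).symm.trans_lt h2
  have e : ∀ φ ψ : S.Extrap, dist φ ψ = ‖φ - ψ‖ := fun φ ψ => dist_eq_norm (E := S.Extrap) φ ψ
  rw [e] at h3 hh ⊢
  have hb : ∀ t ≤ r + 1, ∀ c : ℝ, 0 ≤ c → c < ε / (4 * M) → ‖S.op t‖ * c < ε / 4 := by
    intro t ht c hc hc'
    calc ‖S.op t‖ * c ≤ M * c := by gcongr; exact hMb t ht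
      _ < M * (ε / (4 * M)) := by gcongr
      _ = ε / 4 := by field_simp
  have k1 := hb p.1 h1 ‖p.2 - φ‖ (norm_nonneg (p.2 - φ)) h3
  have k2 := hb p.1 h1 ‖φ - S.embed h‖ (norm_nonneg (φ - S.embed h)) hh
  have k3 := hb r (by simp) ‖φ - S.embed h‖ (norm_nonneg (φ - S.embed h)) hh
  have := S.norm_extOp_sub_extOp_le p.1 r φ p.2 h
  linarith

end Extrapolation

end C0Semigroup

/-! ### Controls and their energy -/

namespace C0Semigroup

section Controls

variable {U : Type*} [NormedAddCommGroup U]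

lemma IsControl.intervalIntegrable {u : ℝ → U} (hu : IsControl u) {t : ℝ} (ht : 0 ≤ t) :
    IntervalIntegrable u volume 0 t := by
  rw [intervalIntegrable_iff_integrableOn_Ioo_of_le ht]
  exact (hu t).integrable (by norm_num)

lemma isControl_of_memLp {u : ℝ → U} (hu : MemLp u 2 volume) : IsControl u := fun _ =>
  hu.restrict _

lemma intervalIntegrable_of_memLp {u : ℝ → U} (hu : MemLp u 2 volume) {t : ℝ} (ht : 0 ≤ t) :
    IntervalIntegrable u volume 0 t :=
  IsControl.intervalIntegrable (isControl_of_memLp hu) ht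

lemma energy_eq_integral {u : ℝ → U} (h0 : ∀ s ≤ 0, u s = 0) : energy u = ∫ s, ‖u s‖ ^ 2 :=
  setIntegral_eq_integral_of_forall_compl_eq_zero fun s hs => by
    simp [h0 s (not_lt.1 hs)]

lemma energy_nonneg (u : ℝ → U) : 0 ≤ energy u :=
  integral_nonneg fun _ => sq_nonneg _

lemma energy_add_le {u v : ℝ → U} (hu : MemLp u 2 volume) (hv : MemLp v 2 volume) :
    energy (fun s => u s + v s) ≤ 2 * energy u + 2 * energy v := by
  unfold energy
  rw [← integral_const_mul, ← integral_const_mul]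
  have hi : ∀ w : ℝ → U, MemLp w 2 volume → IntegrableOn (fun s => ‖w s‖ ^ 2) (Ioi 0) :=
    fun w hw => (hw.integrable_norm_pow two_ne_zero).integrableOn
  rw [← integral_add ((hi u hu).const_mul 2) ((hi v hv).const_mul 2)]
  refine integral_mono (hi _ (hu.add hv)) (((hi u hu).const_mul 2).add ((hi v hv).const_mul 2))
    fun s => ?_
  have h1 := norm_add_le (u s) (v s)
  have h2 : ‖u s + v s‖ ^ 2 ≤ (‖u s‖ + ‖v s‖) ^ 2 := by gcongr
  simp only
  nlinarith [sq_nonneg (‖u s‖ - ‖v s‖)]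

lemma energy_smul [NormedSpace ℂ U] (c : ℂ) (u : ℝ → U) : energy (fun s => c • u s) = ‖c‖ ^ 2 * energy u := by
  unfold energy
  rw [← integral_const_mul]
  simp only [norm_smul, mul_pow]

end Controls

end C0Semigroup

/-! ### Abstract control systems: superposition, free evolution, shift and concatenation -/

/-- A control system `y' = 𝒜 y + b u` in a Banach space `X` whose semigroup extends a
strongly continuous semigroup on `H`. -/
structure ControlSystem (H X U : Type*) [NormedAddCommGroup H] [InnerProductSpace ℂ H]
    [NormedAddCommGroup X] [NormedSpace ℂ X] [NormedAddCommGroup U] [InnerProductSpace ℂ U] where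
  /-- The semigroup on the state space. -/
  sg : C0Semigroup H
  /-- The extended semigroup. -/
  ext : ℝ≥0 → X →L[ℂ] X
  continuous_ext : Continuous fun p : ℝ≥0 × X => ext p.1 p.2
  ext_add : ∀ (s t : ℝ≥0) (φ : X), ext (s + t) φ = ext s (ext t φ)
  ext_zero : ∀ φ : X, ext 0 φ = φ
  /-- The inclusion of the state space. -/
  incl : H →L[ℂ] X
  ext_incl : ∀ (t : ℝ≥0) (h : H), ext t (incl h) = incl (sg.op t h)
  /-- The control operator. -/
  input : U →L[ℂ] X

namespace ControlSystem

open C0Semigroup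

variable {H X U : Type*} [NormedAddCommGroup H] [InnerProductSpace ℂ H]
  [NormedAddCommGroup X] [NormedSpace ℂ X] [NormedAddCommGroup U] [InnerProductSpace ℂ U]

/-- The input-to-state map, a Bochner integral in `X`. -/
noncomputable def inputMap (E : ControlSystem H X U) (u : ℝ → U) (t : ℝ) : X :=
  ∫ s in (0 : ℝ)..t, E.ext (t - s).toNNReal (E.input (u s))

/-- The state at time `t`, as an element of `X`. -/
noncomputable def trajectory (E : ControlSystem H X U) (y : H) (u : ℝ → U) (t : ℝ) : X :=
  E.incl (E.sg.op t.toNNReal y) + E.inputMap u t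

/-- The control `u` steers `y` to rest in time at most `T`. -/
def Steers (E : ControlSystem H X U) (y : H) (T : ℝ) (u : ℝ → U) : Prop :=
  IsControl u ∧ (∀ᵐ t ∂(volume.restrict (Ioi T)), u t = 0) ∧
    ∀ᵐ t ∂(volume.restrict (Ioi T)), E.trajectory y u t = 0

lemma exists_norm_ext_input_le [CompleteSpace X] (E : ControlSystem H X U) (r : ℝ) :
    ∃ K : ℝ, 0 < K ∧ ∀ s : ℝ, 0 ≤ s → ∀ x : U,
      ‖E.ext (r - s).toNNReal (E.input x)‖ ≤ K * ‖x‖ := by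
  obtain ⟨C, hC⟩ := banach_steinhaus (g := fun t : Set.Iic r.toNNReal => E.ext t) (fun φ => by
    have hc : Continuous fun t : ℝ≥0 => E.ext t φ :=
      E.continuous_ext.comp (continuous_id.prodMk continuous_const)
    obtain ⟨C, hC⟩ := (isCompact_Icc (a := (0 : ℝ≥0)) (b := r.toNNReal)).exists_bound_of_continuousOn
      hc.continuousOn
    exact ⟨C, fun t => hC t ⟨zero_le, t.2⟩⟩)
  have hC0 : 0 ≤ C := (norm_nonneg _).trans (hC ⟨0, mem_Iic.2 zero_le⟩)
  refine ⟨(C + 1) * (‖E.input‖ + 1), by positivity, fun s hs x => ?_⟩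
  -- For s > r the truncated time is 0, so one bound on [0, r] serves all s ≥ 0.
  have hle : (r - s).toNNReal ≤ r.toNNReal := Real.toNNReal_le_toNNReal (by linarith)
  calc ‖E.ext (r - s).toNNReal (E.input x)‖ ≤ ‖E.ext (r - s).toNNReal‖ * ‖E.input x‖ :=
        (E.ext _).le_opNorm _
    _ ≤ (C + 1) * ((‖E.input‖ + 1) * ‖x‖) := by
      gcongr
      · exact (hC ⟨_, hle⟩).trans (by linarith)
      · exact E.input.le_of_opNorm_le (by linarith) x
    _ = _ := by ring

lemma aestronglyMeasurable_ext_input (E : ControlSystem H X U) (r : ℝ)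
    {u : ℝ → U} {μ : Measure ℝ} (hu : AEStronglyMeasurable u μ) :
    AEStronglyMeasurable (fun s => E.ext (r - s).toNNReal (E.input (u s))) μ :=
  E.continuous_ext.comp_aestronglyMeasurable₂ (g := fun t φ => E.ext t φ)
    (continuous_real_toNNReal.comp (continuous_const.sub continuous_id)).aestronglyMeasurable
    (E.input.continuous.comp_aestronglyMeasurable hu)

lemma inputMap_smul (E : ControlSystem H X U) (c : ℂ) (u : ℝ → U) (t : ℝ) :
    E.inputMap (fun s => c • u s) t = c • E.inputMap u t := by
  unfold inputMap
  rw [← intervalIntegral.integral_smul]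
  simp only [map_smul]

lemma inputMap_congr (E : ControlSystem H X U) {u v : ℝ → U} {t : ℝ}
    (ht : 0 ≤ t) (h : ∀ᵐ s ∂volume.restrict (Ioo 0 t), u s = v s) :
    E.inputMap u t = E.inputMap v t := by
  unfold inputMap
  rw [intervalIntegral.integral_of_le ht, intervalIntegral.integral_of_le ht,
    ← restrict_Ioo_eq_restrict_Ioc]
  refine integral_congr_ae ?_
  filter_upwards [h] with s hs
  rw [hs]

lemma trajectory_smul (E : ControlSystem H X U) (c : ℂ) (y : H) (u : ℝ → U)
    (t : ℝ) :
    E.trajectory (c • y) (fun s => c • u s) t = c • E.trajectory y u t := by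
  unfold trajectory
  rw [E.inputMap_smul, map_smul, map_smul, smul_add]

/-- `u ∈ L²(ℝ)` vanishes outside of `(0, T]` and brings the state `y` to zero at time `T`. -/
def SteersWithin (E : ControlSystem H X U) (y : H) (T : ℝ) (u : ℝ → U) : Prop :=
  MemLp u 2 volume ∧ (∀ s ∉ Ioc 0 T, u s = 0) ∧ E.trajectory y u T = 0

lemma SteersWithin.smul {E : ControlSystem H X U} {y : H} {T : ℝ}
    {u : ℝ → U} (h : E.SteersWithin y T u) (c : ℂ) :
    E.SteersWithin (c • y) T (fun s => c • u s) :=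
  ⟨h.1.const_smul c, fun s hs => by beta_reduce; rw [h.2.1 s hs, smul_zero],
    by rw [trajectory_smul, h.2.2, smul_zero]⟩

variable [CompleteSpace X]

lemma intervalIntegrable_ext_input (E : ControlSystem H X U) (r : ℝ)
    {u : ℝ → U} {a b : ℝ} (ha : 0 ≤ a) (hb : 0 ≤ b) (hu : IntervalIntegrable u volume a b) :
    IntervalIntegrable (fun s => E.ext (r - s).toNNReal (E.input (u s))) volume a b := by
  obtain ⟨K, hK, hKb⟩ := E.exists_norm_ext_input_le r
  rw [intervalIntegrable_iff] at hu ⊢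
  refine Integrable.mono' (hu.norm.const_mul K)
    (E.aestronglyMeasurable_ext_input r hu.aestronglyMeasurable) ?_
  filter_upwards [ae_restrict_mem measurableSet_uIoc] with s hs
  exact hKb s ((le_min ha hb).trans hs.1.le) _

lemma inputMap_add (E : ControlSystem H X U) {u v : ℝ → U} {t : ℝ} (ht : 0 ≤ t)
    (hu : IntervalIntegrable u volume 0 t) (hv : IntervalIntegrable v volume 0 t) :
    E.inputMap (fun s => u s + v s) t = E.inputMap u t + E.inputMap v t := by
  unfold inputMap
  rw [← intervalIntegral.integral_add (E.intervalIntegrable_ext_input t le_rfl ht hu)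
    (E.intervalIntegrable_ext_input t le_rfl ht hv)]
  simp only [map_add]

/-- Without control after time `τ`, the state follows the extended semigroup. -/
lemma inputMap_add_time (E : ControlSystem H X U) {u : ℝ → U} {τ t : ℝ}
    (hτ : 0 ≤ τ) (ht : 0 ≤ t) (hu : IntervalIntegrable u volume 0 τ)
    (h0 : ∀ᵐ s ∂volume.restrict (Ioi τ), u s = 0) :
    E.inputMap u (τ + t) = E.ext t.toNNReal (E.inputMap u τ) := by
  have hz : ∀ᵐ s ∂volume.restrict (Ioc τ (τ + t)), u s = 0 :=
    ae_restrict_of_ae_restrict_of_subset Ioc_subset_Ioi_self h0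
  have hle : τ ≤ τ + t := by linarith
  have hu2 : IntervalIntegrable u volume τ (τ + t) := by
    rw [intervalIntegrable_iff_integrableOn_Ioc_of_le hle]
    exact (integrable_zero _ _ _).congr (hz.mono fun s hs => hs.symm)
  have h2 : ∫ s in τ..(τ + t), E.ext (τ + t - s).toNNReal (E.input (u s)) = 0 := by
    rw [intervalIntegral.integral_of_le hle]
    refine integral_eq_zero_of_ae (hz.mono fun s hs => ?_)
    simp only [hs, map_zero, Pi.zero_apply]
  unfold inputMap
  rw [← intervalIntegral.integral_add_adjacent_intervals
    (E.intervalIntegrable_ext_input (τ + t) le_rfl hτ hu)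
    (E.intervalIntegrable_ext_input (τ + t) hτ (by linarith) hu2), h2, add_zero,
    
    ← ContinuousLinearMap.intervalIntegral_comp_comm _
      (E.intervalIntegrable_ext_input τ le_rfl hτ hu)]
  refine intervalIntegral.integral_congr fun s hs => ?_
  rw [uIcc_of_le hτ] at hs
  change _ = E.ext _ (E.ext _ _)
  rw [← E.ext_add, ← Real.toNNReal_add ht (sub_nonneg.2 hs.2)]
  congr 3
  ring

/-- A control which starts at time `τ` acts as the shifted control. -/
lemma inputMap_shift (E : ControlSystem H X U) {v : ℝ → U} {τ t : ℝ}
    (hτ : 0 ≤ τ) (ht : 0 ≤ t) (hv : IntervalIntegrable v volume 0 t)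
    (h0 : ∀ s ≤ 0, v s = 0) :
    E.inputMap (fun s => v (s - τ)) (τ + t) = E.inputMap v t := by
  have hz : ∀ s ∈ uIcc 0 τ, E.ext (τ + t - s).toNNReal (E.input (v (s - τ))) = 0 := fun s hs => by
    rw [uIcc_of_le hτ] at hs
    rw [h0 _ (by linarith [hs.2]), map_zero, map_zero]
  have hsub : ∀ s : ℝ, E.ext (τ + t - s).toNNReal (E.input (v (s - τ)))
      = E.ext (t - (s - τ)).toNNReal (E.input (v (s - τ))) := fun s => by
    rw [sub_sub_eq_add_sub, add_comm t τ]
  have h1 : IntervalIntegrable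
      (fun s => E.ext (τ + t - s).toNNReal (E.input (v (s - τ)))) volume 0 τ := by
    refine (intervalIntegrable_const (c := (0 : X))).congr fun s hs => ?_
    exact (hz s (uIoc_subset_uIcc hs)).symm
  have h2 : IntervalIntegrable
      (fun s => E.ext (τ + t - s).toNNReal (E.input (v (s - τ)))) volume τ (τ + t) := by
    simp only [hsub]
    have := (E.intervalIntegrable_ext_input t le_rfl ht hv).comp_sub_right τ
    simpa [add_comm] using this
  unfold inputMap
  rw [← intervalIntegral.integral_add_adjacent_intervals h1 h2,
    intervalIntegral.integral_congr hz]
  simp only [hsub, intervalIntegral.integral_zero, zero_add]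
  rw [intervalIntegral.integral_comp_sub_right (fun s => E.ext (t - s).toNNReal (E.input (v s)))]
  simp

lemma trajectory_add_time (E : ControlSystem H X U) (y : H) {u : ℝ → U} {τ t : ℝ}
    (hτ : 0 ≤ τ) (ht : 0 ≤ t) (hu : IntervalIntegrable u volume 0 τ)
    (h0 : ∀ᵐ s ∂volume.restrict (Ioi τ), u s = 0) :
    E.trajectory y u (τ + t) = E.ext t.toNNReal (E.trajectory y u τ) := by
  unfold trajectory
  rw [E.inputMap_add_time hτ ht hu h0, map_add, 
    E.ext_incl, ← C0Semigroup.op_add_apply, ← Real.toNNReal_add ht hτ, add_comm τ t]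

/-- A steered trajectory is at rest at the final time. -/
lemma Steers.trajectory_eq_zero {E : ControlSystem H X U} {y : H} {T : ℝ}
    {u : ℝ → U} (h : E.Steers y T u) (hT : 0 ≤ T) : E.trajectory y u T = 0 := by
  obtain ⟨hu, h0, hy⟩ := h
  set φ := E.trajectory y u T
  -- After T the solution is the free evolution of its value φ at T. It is continuous and vanishes
  -- almost everywhere, hence everywhere after T, and at T itself by closure.
  have hc : Continuous fun t : ℝ => E.ext (t - T).toNNReal φ :=
    E.continuous_ext.comp
      ((continuous_real_toNNReal.comp (continuous_sub_right T)).prodMk continuous_const)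
  have hae : (fun t : ℝ => E.ext (t - T).toNNReal φ) =ᵐ[volume.restrict (Ioi T)] fun _ => 0 := by
    filter_upwards [hy, ae_restrict_mem measurableSet_Ioi] with t ht htT
    have := E.trajectory_add_time y (t := t - T) hT (sub_nonneg.2 (mem_Ioi.1 htT).le)
      (C0Semigroup.IsControl.intervalIntegrable hu hT) h0
    rw [← this, add_sub_cancel, ht]
  have heq := Measure.eqOn_open_of_ae_eq hae isOpen_Ioi hc.continuousOn continuousOn_const
  have := heq.closure hc continuous_const (x := T) (by rw [closure_Ioi]; exact self_mem_Ici)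
  simpa [ext_zero] using this

/-- Truncation turns an almost-everywhere condition after T into a pointwise one at T, for a control
defined on all of ℝ; such controls can be shifted and added freely. -/
lemma Steers.steersWithin {E : ControlSystem H X U} {y : H} {T : ℝ}
    {u : ℝ → U} (h : E.Steers y T u) (hT : 0 ≤ T) :
    E.SteersWithin y T ((Ioc 0 T).indicator u) := by
  refine ⟨?_, fun s hs => indicator_of_notMem hs u, ?_⟩
  · rw [memLp_indicator_iff_restrict measurableSet_Ioc, ← restrict_Ioo_eq_restrict_Ioc]
    exact h.1 T
  · rw [← h.trajectory_eq_zero hT]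
    unfold trajectory
    congr 1
    refine E.inputMap_congr hT ?_
    filter_upwards [ae_restrict_mem measurableSet_Ioo] with s hs
    exact indicator_of_mem (Ioo_subset_Ioc_self hs) u

lemma SteersWithin.steers {E : ControlSystem H X U} {y : H} {T : ℝ}
    {u : ℝ → U} (h : E.SteersWithin y T u) (hT : 0 ≤ T) : E.Steers y T u := by
  obtain ⟨hu, h0, hy⟩ := h
  have hz : ∀ᵐ s ∂volume.restrict (Ioi T), u s = 0 := by
    filter_upwards [ae_restrict_mem measurableSet_Ioi] with s hs
    exact h0 s fun h => (mem_Ioi.1 hs).not_ge h.2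
  refine ⟨isControl_of_memLp hu, hz, ?_⟩
  filter_upwards [ae_restrict_mem measurableSet_Ioi] with s hs
  have := E.trajectory_add_time y (t := s - T) hT (sub_nonneg.2 (mem_Ioi.1 hs).le)
    (intervalIntegrable_of_memLp hu hT) hz
  rw [add_sub_cancel, hy, map_zero] at this
  exact this

/-- Concatenation of a control bringing `y` to `z` with a control bringing `z` to rest. -/
lemma SteersWithin.concat {E : ControlSystem H X U} {y z : H} {τ T : ℝ}
    {u v : ℝ → U} (hτ : 0 ≤ τ) (hT : 0 ≤ T) (hu : MemLp u 2 volume) (hu0 : ∀ s ∉ Ioc 0 τ, u s = 0)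
    (hyz : E.trajectory y u τ = E.incl z) (hv : E.SteersWithin z T v) :
    E.SteersWithin y (τ + T) (fun s => u s + v (s - τ)) ∧
      energy (fun s => u s + v (s - τ)) = energy u + energy v := by
  obtain ⟨hv, hv0, hvz⟩ := hv
  have hv' : MemLp (fun s => v (s - τ)) 2 volume :=
    hv.comp_measurePreserving (measurePreserving_sub_right volume τ)
  have hu0' : ∀ s ≤ 0, u s = 0 := fun s hs => hu0 s fun h => hs.not_gt h.1
  have hv0' : ∀ s ≤ 0, v s = 0 := fun s hs => hv0 s fun h => hs.not_gt h.1
  refine ⟨⟨hu.add hv', fun s hs => ?_, ?_⟩, ?_⟩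
  · beta_reduce
    rw [hu0 s fun h => hs ⟨h.1, by linarith [h.2]⟩,
      hv0 (s - τ) fun h => hs ⟨by linarith [h.1], by linarith [h.2]⟩, add_zero]
  · have hz : ∀ᵐ s ∂volume.restrict (Ioi τ), u s = 0 := by
      filter_upwards [ae_restrict_mem measurableSet_Ioi] with s hs
      exact hu0 s fun h => (mem_Ioi.1 hs).not_ge h.2
    have h1 := E.trajectory_add_time y hτ hT (intervalIntegrable_of_memLp hu hτ) hz
    have h2 := E.inputMap_shift hτ hT (intervalIntegrable_of_memLp hv hT) hv0'
    rw [hyz, E.ext_incl] at h1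
    unfold trajectory at h1 hvz ⊢
    rw [E.inputMap_add (by positivity) (intervalIntegrable_of_memLp hu (by positivity))
      (intervalIntegrable_of_memLp hv' (by positivity)), ← add_assoc, h1, h2, hvz]
  · rw [energy_eq_integral hu0', energy_eq_integral hv0', energy_eq_integral,
      ← integral_sub_right_eq_self (fun s => ‖v s‖ ^ 2) τ,
      ← integral_add (hu.integrable_norm_pow two_ne_zero) (hv'.integrable_norm_pow two_ne_zero)]
    · refine integral_congr_ae (Eventually.of_forall fun s => ?_)
      -- At each s one of the two controls vanishes, so there is no cross term. At s = τ it is the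
      -- second one, because supports are half-open, in (0, T].
      rcases le_or_gt s τ with h | h
      · simp [hv0' (s - τ) (by linarith)]
      · simp [hu0 s fun h' => h.not_ge h'.2]
    · intro s hs
      rw [hu0' s hs, hv0' (s - τ) (by linarith), add_zero]

lemma trajectory_add (E : ControlSystem H X U) (y z : H) {u v : ℝ → U}
    {t : ℝ} (ht : 0 ≤ t) (hu : IntervalIntegrable u volume 0 t)
    (hv : IntervalIntegrable v volume 0 t) :
    E.trajectory (y + z) (fun s => u s + v s) t
      = E.trajectory y u t + E.trajectory z v t := by
  unfold trajectory
  rw [E.inputMap_add ht hu hv, map_add, map_add]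
  abel

lemma SteersWithin.mono {E : ControlSystem H X U} {y : H} {T T' : ℝ}
    {u : ℝ → U} (h : E.SteersWithin y T u) (hT : 0 ≤ T) (hTT : T ≤ T') :
    E.SteersWithin y T' u := by
  obtain ⟨hu, h0, hy⟩ := h
  have hz : ∀ᵐ s ∂volume.restrict (Ioi T), u s = 0 := by
    filter_upwards [ae_restrict_mem measurableSet_Ioi] with s hs
    exact h0 s fun h => (mem_Ioi.1 hs).not_ge h.2
  refine ⟨hu, fun s hs => h0 s fun h => hs ⟨h.1, h.2.trans hTT⟩, ?_⟩
  have := E.trajectory_add_time y (t := T' - T) hT (sub_nonneg.2 hTT)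
    (intervalIntegrable_of_memLp hu hT) hz
  rw [add_sub_cancel, hy, map_zero] at this
  exact this

lemma SteersWithin.add {E : ControlSystem H X U} {y z : H} {T : ℝ}
    {u v : ℝ → U} (hT : 0 ≤ T) (hu : E.SteersWithin y T u) (hv : E.SteersWithin z T v) :
    E.SteersWithin (y + z) T (fun s => u s + v s) :=
  ⟨hu.1.add hv.1, fun s hs => by beta_reduce; rw [hu.2.1 s hs, hv.2.1 s hs, add_zero],
    by rw [E.trajectory_add y z hT (intervalIntegrable_of_memLp hu.1 hT)
      (intervalIntegrable_of_memLp hv.1 hT), hu.2.2, hv.2.2, add_zero]⟩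

end ControlSystem

/-! ### The infimal cost of steering to rest -/

namespace ControlSystem

open C0Semigroup

section Cost

variable {H X U : Type*} [NormedAddCommGroup H] [InnerProductSpace ℂ H]
  [NormedAddCommGroup X] [NormedSpace ℂ X] [NormedAddCommGroup U] [InnerProductSpace ℂ U]

/-- Every state can be steered to rest within a common time. -/
def NullControllable (E : ControlSystem H X U) : Prop :=
  ∃ T : ℝ, 0 < T ∧ ∀ y : H, ∃ u : ℝ → U, E.SteersWithin y T u

/-- The energies of the controls steering `y` to rest in some finite time. -/
def energies (E : ControlSystem H X U) (y : H) : Set ℝ :=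
  {r | ∃ T : ℝ, 0 < T ∧ ∃ u : ℝ → U, E.SteersWithin y T u ∧ energy u = r}

/-- The infimal energy needed to steer `y` to rest in some finite time. -/
noncomputable def cost (E : ControlSystem H X U) (y : H) : ℝ := sInf (E.energies y)

variable {E : ControlSystem H X U}

lemma cost_nonneg (E : ControlSystem H X U) (y : H) : 0 ≤ E.cost y :=
  Real.sInf_nonneg (by rintro _ ⟨T, -, u, -, rfl⟩; exact energy_nonneg u)

lemma SteersWithin.cost_le {y : H} {T : ℝ} {u : ℝ → U} (h : E.SteersWithin y T u) (hT : 0 < T) :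
    E.cost y ≤ energy u :=
  csInf_le ⟨0, by rintro _ ⟨T, -, u, -, rfl⟩; exact energy_nonneg u⟩ ⟨T, hT, u, h, rfl⟩

lemma NullControllable.exists_energy_lt (hE : E.NullControllable) (y : H) {ε : ℝ} (hε : 0 < ε) :
    ∃ T : ℝ, 0 < T ∧ ∃ u : ℝ → U, E.SteersWithin y T u ∧ energy u < E.cost y + ε := by
  obtain ⟨T, hT, h⟩ := hE
  obtain ⟨u, hu⟩ := h y
  obtain ⟨_, ⟨T', hT', v, hv, rfl⟩, hlt⟩ := exists_lt_of_csInf_lt (s := E.energies y)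
    ⟨energy u, T, hT, u, hu, rfl⟩ (lt_add_of_pos_right (sInf (E.energies y)) hε)
  exact ⟨T', hT', v, hv, hlt⟩

lemma cost_smul_le (hE : E.NullControllable) (c : ℂ) (y : H) :
    E.cost (c • y) ≤ ‖c‖ ^ 2 * E.cost y := by
  refine le_of_forall_pos_le_add fun ε hε => ?_
  -- The summand 1 keeps the denominator positive when c = 0.
  obtain ⟨T, hT, u, hu, hlt⟩ := hE.exists_energy_lt y (ε := ε / (‖c‖ ^ 2 + 1)) (by positivity)
  refine ((hu.smul c).cost_le hT).trans ?_
  rw [energy_smul]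
  calc ‖c‖ ^ 2 * energy u ≤ ‖c‖ ^ 2 * (E.cost y + ε / (‖c‖ ^ 2 + 1)) := by gcongr
    _ = ‖c‖ ^ 2 * E.cost y + ε * (‖c‖ ^ 2 / (‖c‖ ^ 2 + 1)) := by ring
    _ ≤ ‖c‖ ^ 2 * E.cost y + ε * 1 := by
      gcongr
      exact div_le_one_of_le₀ (by linarith) (by positivity)
    _ = _ := by rw [mul_one]

variable [CompleteSpace X]

/-- Two nearly optimal controls are extended by rest to a common final time and added; the factor 2
comes from |a+b|² ≤ 2|a|² + 2|b|². -/
lemma cost_add_le (hE : E.NullControllable) (y z : H) :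
    E.cost (y + z) ≤ 2 * E.cost y + 2 * E.cost z := by
  refine le_of_forall_pos_le_add fun ε hε => ?_
  obtain ⟨T, hT, u, hu, hlt⟩ := hE.exists_energy_lt y (ε := ε / 4) (by positivity)
  obtain ⟨T', hT', v, hv, hlt'⟩ := hE.exists_energy_lt z (ε := ε / 4) (by positivity)
  have hm : 0 < max T T' := lt_max_of_lt_left hT
  have h := ((hu.mono hT.le (le_max_left T T')).add hm.le
    (hv.mono hT'.le (le_max_right T T'))).cost_le hm
  have := energy_add_le hu.1 hv.1
  linarith

/-- Dynamic programming inequality: after reaching z, continue with a nearly optimal control for z.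
-/
lemma cost_le_energy_add_cost (hE : E.NullControllable) {y z : H} {τ : ℝ} {u : ℝ → U}
    (hτ : 0 ≤ τ) (hu : MemLp u 2 volume) (hu0 : ∀ s ∉ Ioc 0 τ, u s = 0)
    (hyz : E.trajectory y u τ = E.incl z) : E.cost y ≤ energy u + E.cost z := by
  refine le_of_forall_pos_le_add fun ε hε => ?_
  obtain ⟨T, hT, v, hv, hlt⟩ := hE.exists_energy_lt z hε
  obtain ⟨h1, h2⟩ := SteersWithin.concat hτ hT.le hu hu0 hyz hv
  have := h1.cost_le (by positivity)
  linarith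

lemma cost_le_cost_op (hE : E.NullControllable) (y : H) (t : ℝ≥0) :
    E.cost y ≤ E.cost (E.sg.op t y) := by
  have h := E.cost_le_energy_add_cost hE (y := y) (z := E.sg.op t y) (u := fun _ => (0 : U))
    t.coe_nonneg MemLp.zero' (fun _ _ => rfl) (by simp [trajectory, inputMap])
  simpa [energy] using h

/-- Apply half of a control steering `z` to rest. -/
lemma SteersWithin.cost_le_quarter (hE : E.NullControllable) {z : H} {τ : ℝ} {u : ℝ → U}
    (hτ : 0 ≤ τ) (hu : E.SteersWithin z τ u) :
    E.cost z ≤ energy u / 4 + E.cost (E.sg.op τ.toNNReal z) / 4 := by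
  obtain ⟨hu, hu0, huz⟩ := hu
  -- Full control contributes -e^{Aτ}z at time τ, so half of it leaves e^{Aτ}z/2, which belongs to
  -- H. Both the energy and the remaining cost scale by 1/4.
  have h := E.cost_le_energy_add_cost hE (y := z) (z := (1 / 2 : ℂ) • E.sg.op τ.toNNReal z)
    (u := fun s => (1 / 2 : ℂ) • u s) hτ (hu.const_smul _)
    (fun s hs => by rw [hu0 s hs, smul_zero]) (by
      unfold trajectory at huz ⊢
      rw [inputMap_smul, eq_neg_of_add_eq_zero_right huz, map_smul]
      module)
  have h2 := E.cost_smul_le hE (1 / 2 : ℂ) (E.sg.op τ.toNNReal z)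
  have hn : ‖(1 / 2 : ℂ)‖ ^ 2 = 1 / 4 := by norm_num
  rw [energy_smul, hn] at h
  rw [hn] at h2
  linarith

/-- If the costs along the orbit of `z` are bounded, then `z` has cost zero. -/
lemma cost_eq_zero_of_bounded (hE : E.NullControllable) {z : H} {M : ℝ}
    (hM : ∀ t : ℝ≥0, E.cost (E.sg.op t z) ≤ M) : E.cost z = 0 := by
  set Q := ⨆ t : ℝ≥0, E.cost (E.sg.op t z)
  have hQ : ∀ t : ℝ≥0, E.cost (E.sg.op t z) ≤ Q :=
    le_ciSup (f := fun t : ℝ≥0 => E.cost (E.sg.op t z)) ⟨M, by rintro _ ⟨t, rfl⟩; exact hM t⟩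
  -- A nearly optimal control for each point of the orbit costs at most Q + ε, and the point it
  -- leads to is half of a later point of the same orbit.
  have hhalf : Q ≤ Q / 2 := by
    refine ciSup_le fun t => le_of_forall_pos_le_add fun ε hε => ?_
    obtain ⟨τ, hτ, u, hu, hlt⟩ := hE.exists_energy_lt (E.sg.op t z) hε
    have h1 := hu.cost_le_quarter hE hτ.le
    rw [← C0Semigroup.op_add_apply] at h1
    linarith [hQ t, hQ (τ.toNNReal + t)]
  have h0 := hQ 0
  rw [C0Semigroup.op_zero_apply] at h0
  exact le_antisymm (by linarith) (E.cost_nonneg z)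

end Cost

/-! ### Quadratic bound on the cost and the closed subspace of zero cost -/

section Controls

variable {U : Type*} [NormedAddCommGroup U]

lemma intervalIntegrable_Lp {T : ℝ} (hT : 0 ≤ T) (u : Lp U 2 (volume.restrict (Ioc 0 T))) :
    IntervalIntegrable u volume 0 T := by
  rw [intervalIntegrable_iff_integrableOn_Ioc_of_le hT]
  exact (Lp.memLp u).integrable (by norm_num)

lemma ae_Ioo_of_ae_Ioc {T : ℝ} {p : ℝ → Prop} (h : ∀ᵐ s ∂volume.restrict (Ioc 0 T), p s) :
    ∀ᵐ s ∂volume.restrict (Ioo 0 T), p s :=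
  ae_restrict_of_ae_restrict_of_subset Ioo_subset_Ioc_self h

lemma integral_norm_le_norm_Lp (T : ℝ) : ∃ c : ℝ, 0 ≤ c ∧
    ∀ u : Lp U 2 (volume.restrict (Ioc 0 T)), ∫ s in Ioc 0 T, ‖u s‖ ≤ c * ‖u‖ := by
  refine ⟨(volume.restrict (Ioc 0 T) univ ^
    (1 / (1 : ENNReal).toReal - 1 / (2 : ENNReal).toReal)).toReal, ENNReal.toReal_nonneg, fun u => ?_⟩
  have h := eLpNorm_le_eLpNorm_mul_rpow_measure_univ (p := 1) (q := 2) (by norm_num)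
    (Lp.memLp u).aestronglyMeasurable
  rw [integral_norm_eq_lintegral_enorm (Lp.memLp u).aestronglyMeasurable,
    ← eLpNorm_one_eq_lintegral_enorm, Lp.norm_def, mul_comm, ← ENNReal.toReal_mul]
  refine ENNReal.toReal_mono (ENNReal.mul_ne_top (Lp.memLp u).eLpNorm_ne_top ?_) h
  exact ENNReal.rpow_ne_top_of_nonneg (by norm_num) (measure_ne_top _ _)

end Controls

lemma energy_indicator_Lp {U : Type*} [NormedAddCommGroup U] [InnerProductSpace ℂ U] {T : ℝ} (u : Lp U 2 (volume.restrict (Ioc 0 T))) :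
    energy ((Ioc 0 T).indicator u) = ‖u‖ ^ 2 := by
  rw [energy_eq_integral fun s hs => indicator_of_notMem (fun h => hs.not_gt h.1) _,
    ← inner_self_eq_norm_sq (𝕜 := ℂ) u, L2.inner_def]
  simp only [inner_self_eq_norm_sq_to_K]
  have h : ∀ s, ‖(Ioc 0 T).indicator u s‖ ^ 2 = (Ioc 0 T).indicator (fun s => ‖u s‖ ^ 2) s := by
    intro s
    by_cases hs : s ∈ Ioc 0 T <;> simp [hs]
  simp only [h]
  rw [integral_indicator measurableSet_Ioc]
  norm_cast

section Bound

variable {H X U : Type*} [NormedAddCommGroup H] [InnerProductSpace ℂ H]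
  [NormedAddCommGroup X] [NormedSpace ℂ X] [CompleteSpace X]
  [NormedAddCommGroup U] [InnerProductSpace ℂ U]

/-- The map sending a control in `L²(0,T;U)` to the state at time `T`. -/
lemma exists_inputMap_clm (E : ControlSystem H X U) {T : ℝ} (hT : 0 ≤ T) :
    ∃ L : Lp U 2 (volume.restrict (Ioc 0 T)) →L[ℂ] X, ∀ u, L u = E.inputMap u T := by
  obtain ⟨K, hK, hKb⟩ := E.exists_norm_ext_input_le T
  obtain ⟨c, hc, hcb⟩ := integral_norm_le_norm_Lp (U := U) T
  refine ⟨LinearMap.mkContinuous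
    { toFun := fun u => E.inputMap u T
      map_add' := fun u v => ?_
      map_smul' := fun a u => ?_ } (K * c) fun u => ?_, fun u => rfl⟩
  · rw [← E.inputMap_add hT (intervalIntegrable_Lp hT u) (intervalIntegrable_Lp hT v)]
    exact E.inputMap_congr hT (ae_Ioo_of_ae_Ioc (Lp.coeFn_add u v))
  · rw [RingHom.id_apply, ← E.inputMap_smul]
    exact E.inputMap_congr hT (ae_Ioo_of_ae_Ioc (Lp.coeFn_smul a u))
  · change ‖E.inputMap u T‖ ≤ _
    unfold inputMap
    rw [intervalIntegral.integral_of_le hT, mul_assoc]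
    refine (norm_integral_le_of_norm_le
      (((Lp.memLp u).integrable (by norm_num)).norm.const_mul K) ?_).trans ?_
    · filter_upwards [ae_restrict_mem measurableSet_Ioc] with s hs
      exact hKb s hs.1.le _
    · rw [integral_const_mul]
      gcongr
      exact hcb u

variable [CompleteSpace H] [CompleteSpace U]

/-- For a null controllable system the cost is bounded by a multiple of the squared norm. -/
lemma exists_cost_le (E : ControlSystem H X U) (hE : E.NullControllable) :
    ∃ C : ℝ, 0 ≤ C ∧ ∀ y : H, E.cost y ≤ C * ‖y‖ ^ 2 := by
  obtain ⟨T, hT, h⟩ := hE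
  obtain ⟨L, hL⟩ := E.exists_inputMap_clm hT.le
  -- The kernel consists of the pairs (y, u) with u bringing y to zero at T. Null controllability
  -- makes its projection to H surjective, and the open mapping theorem yields u with ‖u‖ ≤ C‖y‖.
  let Φ : H × Lp U 2 (volume.restrict (Ioc 0 T)) →L[ℂ] X :=
    (E.incl.comp (E.sg.op T.toNNReal)).coprod L
  have hcl : IsClosed (Φ.ker : Set (H × Lp U 2 (volume.restrict (Ioc 0 T)))) := Φ.isClosed_ker
  have : CompleteSpace Φ.ker := hcl.completeSpace_coe
  let π : Φ.ker →L[ℂ] H := (ContinuousLinearMap.fst ℂ _ _).comp Φ.ker.subtypeL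
  have hmem : ∀ p : H × Lp U 2 (volume.restrict (Ioc 0 T)),
      p ∈ Φ.ker ↔ E.trajectory p.1 p.2 T = 0 := fun p => by
    rw [LinearMap.mem_ker]
    change E.incl (E.sg.op T.toNNReal p.1) + L p.2 = 0 ↔ _
    rw [hL]
    rfl
  have hsurj : Function.Surjective π := fun y => by
    obtain ⟨u, hu, hu0, huy⟩ := h y
    have hu' : MemLp u 2 (volume.restrict (Ioc 0 T)) := hu.restrict _
    refine ⟨⟨(y, hu'.toLp u), (hmem _).2 ?_⟩, rfl⟩
    rw [← huy]
    unfold trajectory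
    congr 1
    exact E.inputMap_congr hT.le (ae_Ioo_of_ae_Ioc hu'.coeFn_toLp)
  obtain ⟨C, hC, hCb⟩ := π.exists_preimage_norm_le hsurj
  refine ⟨C ^ 2, by positivity, fun y => ?_⟩
  obtain ⟨⟨⟨y', u⟩, hk⟩, hky, hkn⟩ := hCb y
  have hy : y' = y := hky
  subst hy
  have hun : ‖u‖ ≤ C * ‖y'‖ := (le_max_right _ _).trans hkn
  have hst : E.SteersWithin y' T ((Ioc 0 T).indicator u) := by
    refine ⟨(memLp_indicator_iff_restrict measurableSet_Ioc).2 (Lp.memLp u),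
      fun s hs => indicator_of_notMem hs _, ?_⟩
    rw [← (hmem _).1 hk]
    unfold trajectory
    congr 1
    refine E.inputMap_congr hT.le ?_
    filter_upwards [ae_restrict_mem measurableSet_Ioo] with s hs
    exact indicator_of_mem (Ioo_subset_Ioc_self hs) _
  refine (hst.cost_le hT).trans ?_
  rw [energy_indicator_Lp, ← mul_pow]
  gcongr

/-- The closed subspace of the states of cost zero. -/
noncomputable def nullCost (E : ControlSystem H X U) (hE : E.NullControllable) :
    Submodule ℂ H where
  carrier := {y | E.cost y = 0}
  zero_mem' := by
    obtain ⟨C, -, hC⟩ := E.exists_cost_le hE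
    exact le_antisymm (by simpa using hC 0) (E.cost_nonneg 0)
  add_mem' {y z} hy hz := by
    have h := E.cost_add_le hE y z
    rw [mem_ofPred_eq] at hy hz
    rw [hy, hz] at h
    exact le_antisymm (by linarith) (E.cost_nonneg _)
  smul_mem' c y hy := by
    have h := E.cost_smul_le hE c y
    rw [mem_ofPred_eq] at hy
    rw [hy, mul_zero] at h
    exact le_antisymm h (E.cost_nonneg _)

lemma mem_nullCost {E : ControlSystem H X U} (hE : E.NullControllable) {y : H} :
    y ∈ E.nullCost hE ↔ E.cost y = 0 := Iff.rfl

/-- For n of zero cost, V(y) ≤ 2V(y - n) ≤ 2C‖y - n‖². -/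
lemma isClosed_nullCost (E : ControlSystem H X U) (hE : E.NullControllable) :
    IsClosed (E.nullCost hE : Set H) := by
  obtain ⟨C, hC0, hC⟩ := E.exists_cost_le hE
  refine isClosed_of_closure_subset fun y hy => ?_
  obtain ⟨n, hn, hlim⟩ := mem_closure_iff_seq_limit.1 hy
  refine le_antisymm ?_ (E.cost_nonneg y)
  have hb : ∀ k, E.cost y ≤ 2 * (C * ‖y - n k‖ ^ 2) := fun k => by
    have h := E.cost_add_le hE (y - n k) (n k)
    rw [sub_add_cancel, (mem_nullCost hE).1 (hn k)] at h
    linarith [hC (y - n k)]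
  have hl : Tendsto (fun k => 2 * (C * ‖y - n k‖ ^ 2)) atTop (𝓝 (2 * (C * ‖y - y‖ ^ 2))) :=
    (((hlim.const_sub y).norm.pow 2).const_mul C).const_mul 2
  simpa using ge_of_tendsto' hl hb

end Bound

end ControlSystem

/-! ### Generalized eigenvectors and their orbits -/

namespace LinearPMap

variable {H : Type*} [NormedAddCommGroup H] [InnerProductSpace ℂ H]

lemma InResolventSet.eq_zero_of_inKerPow {A : H →ₗ.[ℂ] H} {l : ℂ} (hl : A.InResolventSet l) :
    ∀ (k : ℕ) (x : H), A.InKerPow l k x → x = 0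
  | 0, _, hx => hx
  | k + 1, x, ⟨h, hx⟩ => by
    obtain ⟨R, -, hR⟩ := id hl
    have h1 := hR ⟨x, h⟩
    rw [InResolventSet.eq_zero_of_inKerPow hl k _ hx, ContinuousLinearMap.map_zero] at h1
    exact h1.symm

lemma re_nonpos_of_inKerPow {A : H →ₗ.[ℂ] H} (hs : A.spectralBound ≤ 0) {l : ℂ} {k : ℕ} {x : H}
    (hx : A.InKerPow l k x) (hx0 : x ≠ 0) : l.re ≤ 0 := by
  have hl : l ∈ A.unboundedSpectrum := fun hl => hx0 (hl.eq_zero_of_inKerPow k x hx)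
  exact_mod_cast (le_iSup₂ (f := fun (l : ℂ) (_ : l ∈ A.unboundedSpectrum) => (l.re : EReal))
    l hl).trans hs

end LinearPMap

namespace C0Semigroup

variable {H : Type*} [NormedAddCommGroup H] [InnerProductSpace ℂ H]

lemma inKerPow_op (S : C0Semigroup H) (t : ℝ≥0) (l : ℂ) :
    ∀ (k : ℕ) (x : H), S.generator.InKerPow l k x → S.generator.InKerPow l k (S.op t x)
  | 0, x, hx => by
    have hx : x = 0 := hx
    rw [hx, map_zero]
    rfl
  | k + 1, x, ⟨h, hx⟩ => by
    obtain ⟨h', e⟩ := S.generator_op t ⟨x, h⟩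
    refine ⟨h', ?_⟩
    have h1 := inKerPow_op S t l k _ hx
    rw [map_sub, map_smul, ← e] at h1
    exact h1

/-- If the orbit of `l x - A x` stays in a closed subspace `N`, then `e^{At} x` and `e^{lt} x`
agree modulo `N`. -/
lemma op_sub_exp_smul_mem [CompleteSpace H] (S : C0Semigroup H) {N : Submodule ℂ H}
    (hN : IsClosed (N : Set H)) (l : ℂ) (x : S.generator.domain)
    (hx : ∀ s : ℝ≥0, S.op s (l • (x : H) - S.generator x) ∈ N) (t : ℝ≥0) :
    S.op t x - Complex.exp (l * (t : ℝ)) • (x : H) ∈ N := by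
  rw [← hN.submodule_topologicalClosure_eq, ← Submodule.orthogonal_orthogonal_eq_closure,
    Submodule.mem_orthogonal]
  intro n hn
  -- Against n orthogonal to N, the orbit of Ax has the same inner product as l times the orbit of
  -- x. So f has zero right derivative and is constant, which is the claim tested on n, as N is its
  -- own double orthogonal.
  let f : ℝ → ℂ := fun s => Complex.exp (-l * s) * inner ℂ n (S.op s.toNNReal x)
  have hderiv : ∀ s ∈ Ico (0 : ℝ) t, HasDerivWithinAt f 0 (Ici s) s := by
    intro s hs
    have h1 : HasDerivWithinAt (fun s : ℝ => Complex.exp (-l * s))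
        (Complex.exp (-l * s) * (-l * 1)) (Ici s) s :=
      ((Complex.ofRealCLM.hasDerivAt.const_mul (-l)).cexp).hasDerivWithinAt
    have h2 : HasDerivWithinAt (fun s : ℝ => inner ℂ n (S.op s.toNNReal x))
        (inner ℂ n (S.op s.toNNReal (S.generator x))) (Ici s) s :=
      ((innerSL ℂ n).restrictScalars ℝ).hasFDerivAt.comp_hasDerivWithinAt s
        (S.hasDerivWithinAt_op x hs.1)
    have h3 := Submodule.inner_left_of_mem_orthogonal (hx s.toNNReal) hn
    rw [map_sub, map_smul, inner_sub_right, inner_smul_right, sub_eq_zero] at h3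
    refine (h1.mul h2).congr_deriv ?_
    rw [← h3]
    ring
  have hcont : ContinuousOn f (Icc 0 t) := by
    refine Continuous.continuousOn ?_
    exact (Complex.continuous_exp.comp (continuous_const.mul Complex.continuous_ofReal)).mul
      (continuous_const.inner (S.continuous_op_toNNReal x))
  have h := constant_of_has_deriv_right_zero hcont hderiv t ⟨t.coe_nonneg, le_rfl⟩
  simp only [f, Real.toNNReal_coe, Real.toNNReal_zero, Complex.ofReal_zero, mul_zero,
    Complex.exp_zero, one_mul, op_zero_apply] at h
  rw [inner_sub_right, inner_smul_right, ← h, ← mul_assoc, ← Complex.exp_add]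
  simp

end C0Semigroup

/-! ### Vanishing of the cost -/

namespace ControlSystem

open C0Semigroup

variable {H X U : Type*} [NormedAddCommGroup H] [InnerProductSpace ℂ H] [CompleteSpace H]
  [NormedAddCommGroup X] [NormedSpace ℂ X] [CompleteSpace X]
  [NormedAddCommGroup U] [InnerProductSpace ℂ U] [CompleteSpace U] {E : ControlSystem H X U}

lemma cost_eq_zero_of_tendsto (hE : E.NullControllable) {x : H}
    (hx : Tendsto (fun t : ℝ≥0 => E.sg.op t x) atTop (𝓝 0)) : E.cost x = 0 := by
  obtain ⟨C, -, hC⟩ := E.exists_cost_le hE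
  have hl : Tendsto (fun t : ℝ≥0 => C * ‖E.sg.op t x‖ ^ 2) atTop (𝓝 (C * ‖(0 : H)‖ ^ 2)) :=
    (hx.norm.pow 2).const_mul C
  refine le_antisymm ?_ (E.cost_nonneg x)
  simpa using ge_of_tendsto' hl fun t => (cost_le_cost_op hE x t).trans (hC _)

lemma cost_eq_zero_of_inKerPow (hE : E.NullControllable)
    (hs : E.sg.generator.spectralBound ≤ 0) (l : ℂ) :
    ∀ (k : ℕ) (x : H), E.sg.generator.InKerPow l k x → E.cost x = 0
  | 0, x, hx => by
    have hx : x = 0 := hx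
    rw [hx]
    exact (E.nullCost hE).zero_mem
  | k + 1, x, hxk => by
    -- For x = 0 the number l need not be in the spectrum, and nothing is known about its real part.
    rcases eq_or_ne x 0 with rfl | hx0
    · exact (E.nullCost hE).zero_mem
    have hre := LinearPMap.re_nonpos_of_inKerPow hs hxk hx0
    obtain ⟨h, hx⟩ := hxk
    -- The semigroup preserves the kernel of (l - A)^k, so by induction the whole orbit of (l - A)x
    -- has zero cost.
    have hN := E.sg.op_sub_exp_smul_mem (E.isClosed_nullCost hE) l ⟨x, h⟩ fun s =>
      cost_eq_zero_of_inKerPow hE hs l k _ (E.sg.inKerPow_op s l k _ hx)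
    refine cost_eq_zero_of_bounded hE (M := 2 * E.cost x) fun t => ?_
    have h1 := cost_add_le hE (Complex.exp (l * (t : ℝ)) • x)
      (E.sg.op t x - Complex.exp (l * (t : ℝ)) • x)
    rw [add_sub_cancel, (mem_nullCost hE).1 (hN t)] at h1
    have h2 := cost_smul_le hE (Complex.exp (l * (t : ℝ))) x
    have h3 : ‖Complex.exp (l * (t : ℝ))‖ ≤ 1 := by
      rw [Complex.norm_exp, Real.exp_le_one_iff, Complex.re_mul_ofReal]
      exact mul_nonpos_of_nonpos_of_nonneg hre t.coe_nonneg
    have h4 : ‖Complex.exp (l * (t : ℝ))‖ ^ 2 * E.cost x ≤ 1 * E.cost x := by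
      gcongr
      · exact E.cost_nonneg x
      · exact pow_le_one₀ (norm_nonneg _) h3
    linarith

theorem cost_eq_zero (hE : E.NullControllable) (hdec : E.sg.HasSpectralDecomposition)
    (hs : E.sg.generator.spectralBound ≤ 0) (y : H) : E.cost y = 0 := by
  obtain ⟨Hs, H1, -, -, hc, hstab, -, hspan⟩ := hdec
  have h1 : Hs ≤ E.nullCost hE := fun x hx => cost_eq_zero_of_tendsto hE (hstab x hx)
  have h2 : H1 ≤ E.nullCost hE := by
    rw [← hspan]
    refine Submodule.topologicalClosure_minimal _ (Submodule.span_le.2 ?_)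
      (E.isClosed_nullCost hE)
    rintro x ⟨-, l, k, -, hx⟩
    exact cost_eq_zero_of_inKerPow hE hs l k x hx
  have h3 : (⊤ : Submodule ℂ H) ≤ E.nullCost hE := hc.sup_eq_top ▸ sup_le h1 h2
  exact h3 Submodule.mem_top

end ControlSystem

/-! ### Return to the extrapolation space and conclusion -/

namespace C0Semigroup

variable {H U : Type*} [NormedAddCommGroup H] [InnerProductSpace ℂ H] [CompleteSpace H]
  [NormedAddCommGroup U] [InnerProductSpace ℂ U]

/-- The control system on `(dom A*)'` associated with a semigroup and a control operator. -/
noncomputable def controlSystem (S : C0Semigroup H) (B : U →L[ℂ] S.Extrap) :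
    ControlSystem H S.Extrap U where
  sg := S
  ext := S.extOpL
  continuous_ext := S.continuous_extOp
  ext_add := S.extOp_add
  ext_zero := S.extOp_zero
  incl := S.embedL
  ext_incl := S.extOp_embed
  input := B

lemma controlSystem_steers (S : C0Semigroup H) (B : U →L[ℂ] S.Extrap) (y : H) (T : ℝ)
    (u : ℝ → U) : (S.controlSystem B).Steers y T u ↔ S.Steers B y T u := Iff.rfl

lemma NullControllableInTime.nullControllable {S : C0Semigroup H} {B : U →L[ℂ] S.Extrap} {T : ℝ}
    (h : S.NullControllableInTime B T) (hT : 0 < T) : (S.controlSystem B).NullControllable := by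
  refine ⟨T, hT, fun y => ?_⟩
  obtain ⟨u, hu⟩ := h y
  exact ⟨_, ((S.controlSystem_steers B y T u).2 hu).steersWithin hT.le⟩

/-- A square integrable control steering `y` to rest produces a square integrable solution. -/
lemma Steers.mem_admissibleControls {S : C0Semigroup H} {B : U →L[ℂ] S.Extrap}
    (hreg : S.InputRegular B) {y : H} {T : ℝ} {u : ℝ → U} (hT : 0 < T) (hu : MemLp u 2 volume)
    (h : S.Steers B y T u) : u ∈ S.admissibleControls B y := by
  obtain ⟨-, -, hrest⟩ := h
  obtain ⟨Λ, hΛ⟩ := hreg T hT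
  have huT : MemLp u 2 (volume.restrict (Ioo 0 T)) := hu.restrict _
  -- An H-valued version of the solution on (0, T), square integrable by input regularity. Extended
  -- by zero it represents the solution on the whole half-line, since the solution rests after T.
  let v : ℝ → H := fun t => S.op t.toNNReal y + Λ (huT.toLp u) t
  have hv : MemLp v 2 (volume.restrict (Ioo 0 T)) := by
    refine MemLp.add ?_ (Lp.memLp (Λ (huT.toLp u)))
    obtain ⟨M, -, hM⟩ := S.exists_norm_op_le T.toNNReal
    refine MemLp.of_bound (S.continuous_op_toNNReal y).aestronglyMeasurable (M * ‖y‖) ?_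
    filter_upwards [ae_restrict_mem measurableSet_Ioo] with t ht
    exact (S.op _).le_of_opNorm_le (hM _ (Real.toNNReal_le_toNNReal ht.2.le)) y
  refine ⟨hu.restrict _, (Ioo 0 T).indicator v,
    ((memLp_indicator_iff_restrict measurableSet_Ioo).2 hv).restrict _, ?_⟩
  have h1 : ∀ᵐ t ∂(volume.restrict (Ioo 0 T)),
      S.embed ((Ioo 0 T).indicator v t) = S.trajectory B y u t := by
    filter_upwards [hΛ (huT.toLp u), ae_restrict_mem measurableSet_Ioo] with t ht htT
    have h2 : S.inputMap B (huT.toLp u) t = S.inputMap B u t :=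
      (S.controlSystem B).inputMap_congr htT.1.le (ae_restrict_of_ae_restrict_of_subset
        (Ioo_subset_Ioo_right htT.2.le) huT.coeFn_toLp)
    rw [indicator_of_mem htT]
    unfold trajectory
    rw [← h2, ← ht]
    exact map_add S.embedL _ _
  have h2 : ∀ᵐ t ∂(volume.restrict (Ioi T)),
      S.embed ((Ioo 0 T).indicator v t) = S.trajectory B y u t := by
    filter_upwards [hrest, ae_restrict_mem measurableSet_Ioi] with t ht htT
    rw [ht, indicator_of_notMem fun h => (mem_Ioi.1 htT).not_gt h.2]
    exact map_zero S.embedL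
  rw [restrict_Ioo_eq_restrict_Ioc] at h1
  rw [← Ioc_union_Ioi_eq_Ioi hT.le]
  exact ae_restrict_union_iff _ _ _ |>.2 ⟨h1, h2⟩

end C0Semigroup

theorem theorem2 {H U : Type*}
    [NormedAddCommGroup H] [InnerProductSpace ℂ H] [CompleteSpace H]
    [NormedAddCommGroup U] [InnerProductSpace ℂ U] [CompleteSpace U]
    (S : C0Semigroup H) (B : U →L[ℂ] S.Extrap)
    (hreg : S.InputRegular B)
    (hdec : S.HasSpectralDecomposition)
    (hs : S.generator.spectralBound ≤ 0)
    (hctrl : ∃ T : ℝ, 0 < T ∧ S.NullControllableInTime B T) :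
    S.IsNCVE B ∧
      ∀ P : H →L[ℂ] H, S.IsMinimalEnergyOperator B P ↔ P = 0 := by
  obtain ⟨T₀, hT₀, hT₀c⟩ := hctrl
  have hE := hT₀c.nullControllable hT₀
  have key : ∀ (y : H) (ε : ℝ), 0 < ε → ∃ T : ℝ, 0 < T ∧ ∃ u : ℝ → U,
      S.Steers B y T u ∧ MemLp u 2 volume ∧ C0Semigroup.energy u < ε := by
    intro y ε hε
    obtain ⟨T, hT, u, hu, hlt⟩ := hE.exists_energy_lt y hε
    rw [ControlSystem.cost_eq_zero hE hdec hs y, zero_add] at hlt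
    exact ⟨T, hT, u, hu.steers hT.le, hu.1, hlt⟩
  have hglb : ∀ y : H, IsGLB (C0Semigroup.energy '' S.admissibleControls B y) 0 := by
    refine fun y => ⟨?_, fun r hr => le_of_forall_pos_le_add fun ε hε => ?_⟩
    · rintro _ ⟨u, -, rfl⟩
      exact C0Semigroup.energy_nonneg u
    · obtain ⟨T, hT, u, hu, hu2, hlt⟩ := key y ε hε
      have := hr ⟨u, hu.mem_admissibleControls hreg hT hu2, rfl⟩
      linarith
  refine ⟨fun y ε hε => ?_, fun P => ⟨fun ⟨hP, hPy⟩ => ?_, ?_⟩⟩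
  · obtain ⟨T, hT, u, hu, -, hlt⟩ := key y (ε ^ 2) (by positivity)
    exact ⟨T, hT, u, hu, hlt.le⟩
  · have hsym : (P : H →ₗ[ℂ] H).IsSymmetric :=
      ContinuousLinearMap.isSelfAdjoint_iff_isSymmetric.1 hP
    -- Only the real part of the form is prescribed; symmetry makes the form real, so it vanishes
    -- identically.
    have h0 : (P : H →ₗ[ℂ] H) = 0 := by
      rw [← hsym.inner_map_self_eq_zero]
      intro y
      rw [← hsym.coe_re_inner_apply_self, inner_re_symm]
      have h0 : RCLike.re (inner ℂ y (P y)) = 0 := (hPy y).unique (hglb y)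
      exact (congrArg _ h0).trans RCLike.ofReal_zero
    exact ContinuousLinearMap.coe_injective h0
  · rintro rfl
    refine ⟨IsSelfAdjoint.zero _, fun y => ?_⟩
    simpa using hglb y
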